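/- A complex Hadamard matrix of order $d$ is a unitary $d\times d$ matrix whose entries all have the same modulus; it belongs to $BH(d,r)$ if its entries are $r$-th roots of unity up to the factor $1/\sqrt d$. Two such matrices $H,K$ are equivalent if $H=D_1P_1KP_2D_2$ with $D_1,D_2$ diagonal matrices of phase factors and $P_1,P_2$ permutation matrices. The defect $d(H)$ is the dimension of the space of real $d\times d$ matrices $R$ with zero first row and first column such that $\sum_k H_{ik}\overline{H_{jk}}\,(R_{ik}-R_{jk})=0$ for all $i,j$ (i.e. $(H_{jk}e^{itR_{jk}})_{j,k}$ satisfies the unitarity equations to first order in $t$ at $t=0$). A complex Hadamard matrix $H$ is isolated if all complex Hadamard matrices in some neighbourhood of $H$ are equivalent to $H$. Let $F_d=\frac1{\sqrt d}\bigl(e^{2\pi i jk/d}\bigr)_{0\le j,k<d}$ be the Fourier matrix, $\omega=e^{2\pi i/5}$, $\alpha=e^{2\pi i/3}$, $D=\mathrm{diag}(1,\omega,\omega^4,\omega^4,\omega)$, $H_j=D^jF_5$ for $j=1,2,3,4$, and $$S_{15}=\frac1{\sqrt3}\begin{pmatrix}F_5&H_3&H_4\\ H_1^\dagger F_5&\alpha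 H_1^\dagger H_3&\alpha^2H_1^\dagger H_4\\ H_2^\dagger F_5&\alpha^2H_2^\dagger H_3&\alpha H_2^\dagger H_4\end{pmatrix}.$$ Let $F_{15}^{(8)}$ be the eight-parameter Fourier family, i.e. the set of all matrices $\bigl((F_{15})_{jk}\,e^{iR_{jk}}\bigr)_{0\le j,k<15}$ where $R$ is a real matrix whose entry $R_{jk}$ depends only on $j \bmod 3$ and $k\bmod 5$ and vanishes if $3\mid j$ or $5\mid k$. Proposition. The matrices $I_5,F_5,H_1,H_2,H_3,H_4$ form a complete set of six mutually unbiased bases of $\mathbb C^5$ (each is unitary, and for any two different ones $A,B$ all entries of $A^\dagger B$ have squared modulus $1/5$). The matrix $S_{15}$ belongs to $BH(15,30)$, has defect $d(S_{15})=0$, and is isolated. It is inequivalent to every member of $F_{15}^{(8)}$ and to the transpose of every member of $F_{15}^{(8)}$. -/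

import Mathlib

open scoped Matrix Topology

noncomputable section

/-- A complex Hadamard matrix of order `d`: a unitary matrix all of whose entries have the
same modulus. -/
def IsComplexHadamard {d : ℕ} (H : Matrix (Fin d) (Fin d) ℂ) : Prop :=
  H ∈ Matrix.unitaryGroup (Fin d) ℂ ∧ ∀ i j k l, ‖H i j‖ = ‖H k l‖

/-- The class `BH(d, r)` of Butson-Hadamard matrices: complex Hadamard matrices of order `d`
whose entries are `r`-th roots of unity apart from a factor `1 / √d`. -/
def IsButsonHadamard (d r : ℕ) (H : Matrix (Fin d) (Fin d) ℂ) : Prop :=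
  IsComplexHadamard H ∧ ∀ i j, ∃ z : ℂ, z ^ r = 1 ∧ H i j = z / (Real.sqrt d : ℂ)

/-- Equivalence of Hadamard matrices: `H = D₁ P₁ K P₂ D₂` with `D₁, D₂` diagonal matrices of
phase factors and `P₁, P₂` permutation matrices. -/
def HadamardEquiv {d : ℕ} (H K : Matrix (Fin d) (Fin d) ℂ) : Prop :=
  ∃ (u v : Fin d → ℂ) (σ τ : Equiv.Perm (Fin d)),
    (∀ i, ‖u i‖ = 1) ∧ (∀ i, ‖v i‖ = 1) ∧
      H = Matrix.diagonal u * σ.permMatrix ℂ * K * τ.permMatrix ℂ * Matrix.diagonal v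

/-- The entrywise product `H ∘ EXP(i R)`. -/
def phaseTwist {d : ℕ} (H : Matrix (Fin d) (Fin d) ℂ) (R : Matrix (Fin d) (Fin d) ℝ) :
    Matrix (Fin d) (Fin d) ℂ :=
  Matrix.of fun i j => H i j * Complex.exp (Complex.I * (R i j : ℂ))

/-- The affine family `H(𝓡) = {H ∘ EXP(i R) : R ∈ 𝓡}` stemming from `H`, for a linear space `𝓡`
of real matrices. -/
def affineFamily {d : ℕ} (H : Matrix (Fin d) (Fin d) ℂ)
    (𝓡 : Submodule ℝ (Matrix (Fin d) (Fin d) ℝ)) : Set (Matrix (Fin d) (Fin d) ℂ) :=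
  {K | ∃ R ∈ 𝓡, K = phaseTwist H R}

/-- The real matrices `R` with vanishing first row and first column for which `H ∘ EXP(i t R)`
satisfies the unitarity equations to first order in `t` at `t = 0`: the derivative there of the
`(i, j)` entry of `(H ∘ EXP(i t R)) (H ∘ EXP(i t R))†` is `√-1` times the sum below.  Multiplying
rows and columns of `H` by phase factors multiplies each such sum by a phase factor only, so that
the space is the same for `H` and for its dephased form. -/
def firstOrderSpace {d : ℕ} [NeZero d] (H : Matrix (Fin d) (Fin d) ℂ) :
    Submodule ℝ (Matrix (Fin d) (Fin d) ℝ) where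
  carrier := {R | (∀ j, R 0 j = 0) ∧ (∀ i, R i 0 = 0) ∧
    ∀ i j, ∑ k, H i k * star (H j k) * ((R i k : ℂ) - (R j k : ℂ)) = 0}
  zero_mem' := by simp
  add_mem' := by
    rintro R T ⟨h1, h2, h3⟩ ⟨g1, g2, g3⟩
    refine ⟨fun j => by simp [h1, g1], fun i => by simp [h2, g2], fun i j => ?_⟩
    have h := congrArg₂ (· + ·) (h3 i j) (g3 i j)
    simp only [add_zero, ← Finset.sum_add_distrib] at h
    rw [← h]
    refine Finset.sum_congr rfl fun k _ => ?_
    simp only [Matrix.add_apply, Complex.ofReal_add]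
    ring
  smul_mem' := by
    rintro c R ⟨h1, h2, h3⟩
    refine ⟨fun j => by simp [h1], fun i => by simp [h2], fun i j => ?_⟩
    have h := congrArg (fun z => (c : ℂ) * z) (h3 i j)
    simp only [mul_zero, Finset.mul_sum] at h
    rw [← h]
    refine Finset.sum_congr rfl fun k _ => ?_
    simp only [Matrix.smul_apply, smul_eq_mul, Complex.ofReal_mul]
    ring

/-- The defect `d(H)`: the number of free parameters, to first order, in the phases of the entries
outside the first row and column. -/
def defect {d : ℕ} [NeZero d] (H : Matrix (Fin d) (Fin d) ℂ) : ℕ :=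
  Module.finrank ℝ (firstOrderSpace H)

/-- An isolated complex Hadamard matrix: all complex Hadamard matrices in some neighbourhood of `H`
are equivalent to `H`. -/
def IsIsolatedHadamard {d : ℕ} (H : Matrix (Fin d) (Fin d) ℂ) : Prop :=
  IsComplexHadamard H ∧ ∀ᶠ K in 𝓝 H, IsComplexHadamard K → HadamardEquiv H K

/-- A complete set of `q + 1` mutually unbiased bases of `ℂ^q`.  The vectors of the `k`-th basis are
the columns of `B k`; the `(i, j)` entry of `(B k)† (B l)` is the inner product of the `i`-th vector
of the `k`-th basis with the `j`-th vector of the `l`-th basis. -/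
def IsCompleteMUBSet (q : ℕ) (B : Fin (q + 1) → Matrix (Fin q) (Fin q) ℂ) : Prop :=
  (∀ k, B k ∈ Matrix.unitaryGroup (Fin q) ℂ) ∧
    ∀ k l, k ≠ l → ∀ i j, ‖((B k)ᴴ * B l) i j‖ ^ 2 = 1 / (q : ℝ)

/-- The Fourier matrix `F_d`, with entries `e^{2πi jk/d} / √d` for `j, k = 0, …, d - 1`. -/
def fourierMatrix (d : ℕ) : Matrix (Fin d) (Fin d) ℂ :=
  Matrix.of fun j k =>
    Complex.exp (2 * Real.pi * Complex.I / d) ^ (j.val * k.val) / (Real.sqrt d : ℂ)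

/-- The `pq × pq` block matrix whose `(m, n)` block of size `q × q` is `M m n • (K m)† (L n)`. -/
def blockHadamard (p q : ℕ) (K L : Fin p → Matrix (Fin q) (Fin q) ℂ)
    (M : Matrix (Fin p) (Fin p) ℂ) : Matrix (Fin (p * q)) (Fin (p * q)) ℂ :=
  Matrix.reindex finProdFinEquiv finProdFinEquiv
    (Matrix.of fun x y : Fin p × Fin q => M x.1 y.1 * ((K x.1)ᴴ * L y.1) x.2 y.2)

/-- The matrix `D = diag(1, ω, ω⁴, ω⁴, ω)` with `ω = e^{2πi/5}`. -/
def mubDiag5 : Matrix (Fin 5) (Fin 5) ℂ :=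
  let ω : ℂ := Complex.exp (2 * Real.pi * Complex.I / 5)
  Matrix.diagonal ![1, ω, ω ^ 4, ω ^ 4, ω]

/-- The matrices `H_j = D^j F₅`. -/
def mubH5 (j : ℕ) : Matrix (Fin 5) (Fin 5) ℂ := mubDiag5 ^ j * fourierMatrix 5

/-- The six bases `I₅, F₅, H₁, H₂, H₃, H₄` of `ℂ⁵`. -/
def mubSet5 : Fin 6 → Matrix (Fin 5) (Fin 5) ℂ :=
  ![1, fourierMatrix 5, mubH5 1, mubH5 2, mubH5 3, mubH5 4]

/-- The matrix `S₁₅`: the block matrix with `K = (I₅, H₁, H₂)`, `L = (F₅, H₃, H₄)` and `M = F₃`. -/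
def S15 : Matrix (Fin 15) (Fin 15) ℂ :=
  blockHadamard 3 5 ![mubSet5 0, mubSet5 2, mubSet5 3] ![mubSet5 1, mubSet5 4, mubSet5 5]
    (fourierMatrix 3)

/-- The eight-dimensional space of real `15 × 15` matrices whose entries in row `i` and column `j`
(counted from `0`) depend only on `i mod 3` and `j mod 5`, and vanish if `3 ∣ i` or `5 ∣ j`. -/
def fourierPhaseSpace15 : Submodule ℝ (Matrix (Fin 15) (Fin 15) ℝ) where
  carrier := {R | (∀ i j : Fin 15, i.val % 3 = 0 ∨ j.val % 5 = 0 → R i j = 0) ∧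
    ∀ i j i' j' : Fin 15, i.val % 3 = i'.val % 3 → j.val % 5 = j'.val % 5 → R i j = R i' j'}
  zero_mem' := by simp
  add_mem' := by
    rintro R T ⟨h1, h2⟩ ⟨g1, g2⟩
    refine ⟨fun i j h => ?_, fun i j i' j' hi hj => ?_⟩
    · rw [Matrix.add_apply, h1 i j h, g1 i j h, add_zero]
    · rw [Matrix.add_apply, Matrix.add_apply, h2 i j i' j' hi hj, g2 i j i' j' hi hj]
  smul_mem' := by
    rintro c R ⟨h1, h2⟩
    refine ⟨fun i j h => ?_, fun i j i' j' hi hj => ?_⟩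
    · rw [Matrix.smul_apply, h1 i j h, smul_zero]
    · rw [Matrix.smul_apply, Matrix.smul_apply, h2 i j i' j' hi hj]

/-- The eight-parameter Fourier family `F₁₅⁽⁸⁾`, the affine family stemming from `F₁₅`. -/
def fourierFamily15 : Set (Matrix (Fin 15) (Fin 15) ℂ) :=
  affineFamily (fourierMatrix 15) fourierPhaseSpace15

end

/-! Every entry of `S15` is a power of ζ = e^{2πi/30} divided by √15: the products H_m† H_n have
entries that are quadratic Gauss sums modulo 5, evaluated by completing the square. The same
evaluation gives unbiasedness, and `S15` is unitary by a block computation.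

The core is that the first-order equations for `S15` have only the trivial solutions a_i + b_k
(`complexFirstOrderSpace_le`). The Weyl shift and modulation operators on ℂ⁵ permute the vectors of
each basis up to phases, so (ℤ/5)² acts on the rows and columns of `S15` and preserves the
complexified solution space. That space therefore splits by characters (s, t). On each of the nine
blocks the group is simply transitive on the 25 positions, so a solution with a given character is
determined by nine numbers. A nontrivial character is trivial on exactly one of the six subgroups of
order five, which are the stabilizers belonging to the three row blocks and three column blocks;
this yields one trivial solution and leaves eight unknowns. The trivial character leaves four. Each
remaining system is nonsingular already after reduction modulo 31, with ζ sent to 3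
(`eq_zero_of_mulVec_eq_zero_of_mod`, `leftInverse_mul_blockCoeff`).

Zero defect forces isolation: after dephasing, a nearby Hadamard matrix differs from the given one
by small phases R whose linear term is O(‖R‖²), while the linear map is injective, hence bounded
below. It also excludes the Fourier families, because every member has a nontrivial first-order
solution and equivalence transports such solutions. -/

/-! ### Roots of unity and quadratic Gauss sums modulo five -/

/-- The primitive thirtieth root of unity `e^{2πi/30}`. -/
noncomputable def zeta30 : ℂ := Complex.exp (2 * Real.pi * Complex.I / 30)

theorem zeta30_isPrimitiveRoot : IsPrimitiveRoot zeta30 30 := by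
  simpa [zeta30] using Complex.isPrimitiveRoot_exp 30 (by norm_num)

theorem zeta30_pow_eq_of_mod {a b : ℕ} (h : a % 30 = b % 30) : zeta30 ^ a = zeta30 ^ b := by
  rw [pow_eq_pow_mod a zeta30_isPrimitiveRoot.pow_eq_one, h,
    ← pow_eq_pow_mod b zeta30_isPrimitiveRoot.pow_eq_one]

theorem zeta30_ne_zero : zeta30 ≠ 0 := Complex.exp_ne_zero _

theorem norm_zeta30 : ‖zeta30‖ = 1 :=
  zeta30_isPrimitiveRoot.norm'_eq_one (by norm_num)

theorem norm_zeta30_pow (n : ℕ) : ‖zeta30 ^ n‖ = 1 := by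
  rw [norm_pow, norm_zeta30, one_pow]

/-- Conjugation is inversion on the unit circle. Exponents stay natural numbers throughout, with 29
playing the role of -1 modulo 30. -/
theorem star_zeta30 : star zeta30 = zeta30 ^ 29 := by
  have h1 : zeta30 * star zeta30 = 1 := by
    have := Complex.mul_conj zeta30
    rw [Complex.normSq_eq_norm_sq, norm_zeta30] at this
    simpa using this
  have h2 : zeta30 * zeta30 ^ 29 = 1 := by
    rw [← pow_succ', zeta30_isPrimitiveRoot.pow_eq_one]
  exact mul_left_cancel₀ zeta30_ne_zero (h1.trans h2.symm)

theorem star_zeta30_pow (n : ℕ) : star (zeta30 ^ n) = zeta30 ^ (29 * n) := by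
  rw [star_pow, star_zeta30, pow_mul]

theorem exp_div_five_eq : Complex.exp (2 * Real.pi * Complex.I / 5) = zeta30 ^ 6 := by
  rw [zeta30, ← Complex.exp_nat_mul]
  congr 1
  push_cast
  ring

theorem exp_div_three_eq : Complex.exp (2 * Real.pi * Complex.I / 3) = zeta30 ^ 10 := by
  rw [zeta30, ← Complex.exp_nat_mul]
  congr 1
  push_cast
  ring

theorem zeta30_pow_fifteen : zeta30 ^ 15 = -1 := by
  rw [zeta30, ← Complex.exp_nat_mul, ← Complex.exp_pi_mul_I]
  congr 1
  push_cast
  ring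

theorem sum_zeta30_pow_six :
    1 + zeta30 ^ 6 + zeta30 ^ 12 + zeta30 ^ 18 + zeta30 ^ 24 = 0 := by
  have h := (zeta30_isPrimitiveRoot.pow (by norm_num) (show 30 = 6 * 5 by norm_num)).geom_sum_eq_zero
    (by norm_num)
  simp only [Finset.sum_range_succ, Finset.sum_range_zero, ← pow_mul] at h
  simpa using h

/-- The right side is the Gauss sum of ω^(k²) over k modulo 5; its sign comes from the known value
of cos(π/5). -/
theorem sqrt_five_eq : (Real.sqrt 5 : ℂ) = 1 + 2 * zeta30 ^ 6 + 2 * zeta30 ^ 24 := by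
  have hre : (zeta30 ^ 6 + zeta30 ^ 24 : ℂ) = ((2 * Real.cos (2 * (Real.pi / 5)) : ℝ) : ℂ) := by
    have h24 : zeta30 ^ 24 = Complex.exp (-(2 * (Real.pi / 5) : ℂ) * Complex.I) := by
      have : zeta30 ^ 6 * zeta30 ^ 24 = 1 := by
        rw [← pow_add, zeta30_isPrimitiveRoot.pow_eq_one]
      rw [← exp_div_five_eq] at this
      rw [eq_inv_of_mul_eq_one_right this, ← Complex.exp_neg]
      congr 1
      ring
    rw [h24, ← exp_div_five_eq]
    push_cast
    rw [Complex.two_cos]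
    congr 2
    ring
  have h5 : Real.sqrt 5 = 1 + 2 * (2 * Real.cos (2 * (Real.pi / 5))) := by
    rw [Real.cos_two_mul, Real.cos_pi_div_five]
    have := Real.sq_sqrt (show (0 : ℝ) ≤ 5 by norm_num)
    nlinarith
  rw [h5, Complex.ofReal_add, Complex.ofReal_mul, ← hre]
  push_cast
  ring

/-- The exponent `15 [u is a nonresidue] + 6 v² / u`, where the quotient is taken modulo five, such
that `∑ k, ω ^ (u k² + v k) = √5 ζ₃₀ ^ gaussExp u v` for `u` prime to five. -/
def gaussExp (u v : ℕ) : ℕ :=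
  (if u % 5 = 2 ∨ u % 5 = 3 then 15 else 0) + 6 * (v ^ 2 * u ^ 3)

theorem sum_zeta30_pow_mul_sq {u : ℕ} (hu : u % 5 ≠ 0) :
    ∑ k : Fin 5, zeta30 ^ (6 * (u * k.val ^ 2)) =
      Real.sqrt 5 * zeta30 ^ (if u % 5 = 2 ∨ u % 5 = 3 then 15 else 0) := by
  have key : ∀ k : ℕ, zeta30 ^ (6 * (u * k ^ 2)) = zeta30 ^ (6 * (u % 5 * k ^ 2)) := fun k => by
    apply zeta30_pow_eq_of_mod
    rw [show 30 = 6 * 5 by norm_num, Nat.mul_mod_mul_left, Nat.mul_mod_mul_left]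
    simp [Nat.mul_mod]
  simp only [key]
  have hlt : u % 5 < 5 := Nat.mod_lt _ (by norm_num)
  have h30 := zeta30_isPrimitiveRoot.pow_eq_one
  have hs := sum_zeta30_pow_six
  generalize u % 5 = w at *
  have red : ∀ n, zeta30 ^ n = zeta30 ^ (n % 30) := fun n => zeta30_pow_eq_of_mod (by simp)
  rw [sqrt_five_eq]
  interval_cases w
  · exact absurd rfl hu
  all_goals
    simp only [Fin.sum_univ_five]
    norm_num [zeta30_pow_fifteen]
  · rw [red 54, red 96]
    norm_num
    ring
  · rw [red 48, red 108, red 192]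
    norm_num
    linear_combination 2 * hs
  · rw [red 72, red 162, red 288]
    norm_num
    linear_combination 2 * hs
  · rw [red 96, red 216, red 384]
    norm_num
    ring

theorem sum_zeta30_pow_quadratic {u : ℕ} (v : ℕ) (hu : u % 5 ≠ 0) :
    ∑ k : Fin 5, zeta30 ^ (6 * (u * k.val ^ 2 + v * k.val)) =
      Real.sqrt 5 * zeta30 ^ gaussExp u v := by
  have h := sum_zeta30_pow_mul_sq hu
  -- Completing the square modulo 5: 3 v u³ is v/(2u), and the constant left over is -v²/(4u) = v²/u
  -- = v² u³.
  have hsq : ∀ k : Fin 5, zeta30 ^ (6 * (u * k.val ^ 2 + v * k.val)) =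
      zeta30 ^ (6 * (v ^ 2 * u ^ 3)) *
        zeta30 ^ (6 * (u * (k + Fin.ofNat 5 (3 * v * u ^ 3)).val ^ 2)) := fun k => by
    rw [← pow_add]
    apply zeta30_pow_eq_of_mod
    rw [← mul_add, show 30 = 6 * 5 by norm_num, Nat.mul_mod_mul_left, Nat.mul_mod_mul_left]
    congr 1
    change (_ : ℕ) ≡ _ [MOD 5]
    rw [← ZMod.natCast_eq_natCast_iff]
    have hu0 : (u : ZMod 5) ≠ 0 := by
      intro h0
      exact hu (Nat.mod_eq_zero_of_dvd ((ZMod.natCast_eq_zero_iff u 5).1 h0))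
    have hk : (((k + Fin.ofNat 5 (3 * v * u ^ 3)).val : ℕ) : ZMod 5) =
        (k.val : ZMod 5) + 3 * v * u ^ 3 := by
      rw [Fin.val_add, ZMod.natCast_mod, Nat.cast_add, Fin.val_ofNat, ZMod.natCast_mod]
      push_cast
      ring
    push_cast
    rw [hk]
    generalize (u : ZMod 5) = a at *
    generalize (v : ZMod 5) = b at *
    generalize ((k.val : ℕ) : ZMod 5) = c at *
    clear hk
    revert a b c
    decide
  simp only [hsq, ← Finset.mul_sum]
  have hshift := Equiv.sum_comp (Equiv.addRight (Fin.ofNat 5 (3 * v * u ^ 3)))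
    fun k : Fin 5 => zeta30 ^ (6 * (u * k.val ^ 2))
  simp only [Equiv.coe_addRight] at hshift
  rw [hshift, h, gaussExp, pow_add]
  ring

/-! ### Fourier matrices and the mutually unbiased bases -/

theorem fourierMatrix_mem_unitaryGroup (d : ℕ) [NeZero d] :
    fourierMatrix d ∈ Matrix.unitaryGroup (Fin d) ℂ := by
  rw [Matrix.mem_unitaryGroup_iff]
  have hd : d ≠ 0 := NeZero.ne d
  have hp := Complex.isPrimitiveRoot_exp d hd
  have hd0 : (d : ℂ) ≠ 0 := by exact_mod_cast hd
  set w := Complex.exp (2 * Real.pi * Complex.I / d) with hw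
  have hn : ‖w‖ = 1 := hp.norm'_eq_one hd
  have hw0 : w ≠ 0 := Complex.exp_ne_zero _
  have hstar : star w = w⁻¹ := by
    rw [Complex.inv_def, Complex.normSq_eq_norm_sq, hn]
    simp
  have hsq : (Real.sqrt d : ℂ) * (Real.sqrt d : ℂ) = d := by
    rw [← Complex.ofReal_mul, Real.mul_self_sqrt (Nat.cast_nonneg d)]
    simp
  ext i j
  have hterm : ∀ k : Fin d, fourierMatrix d i k * star (fourierMatrix d) k j =
      (w ^ (i : ℕ) * (w⁻¹) ^ (j : ℕ)) ^ (k : ℕ) / d := fun k => by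
    simp only [fourierMatrix, Matrix.star_apply, Matrix.of_apply, ← hw, star_div₀, star_pow, hstar,
      Complex.star_def, Complex.conj_ofReal]
    rw [div_mul_div_comm, hsq, pow_mul, pow_mul, mul_pow]
  rw [Matrix.mul_apply, Finset.sum_congr rfl fun k _ => hterm k, ← Finset.sum_div,
    Fin.sum_univ_eq_sum_range (fun k => (w ^ (i : ℕ) * (w⁻¹) ^ (j : ℕ)) ^ k) d]
  rcases eq_or_ne i j with rfl | hij
  · rw [← mul_pow, mul_inv_cancel₀ hw0]
    simp [hd0]
  · rw [Matrix.one_apply_ne hij]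
    have hne : w ^ (i : ℕ) * (w⁻¹) ^ (j : ℕ) ≠ 1 := by
      intro h
      rw [inv_pow, mul_inv_eq_one₀ (pow_ne_zero _ hw0)] at h
      exact hij (Fin.ext (hp.pow_inj i.2 j.2 h))
    have h1 : (w ^ (i : ℕ) * (w⁻¹) ^ (j : ℕ)) ^ d = 1 := by
      rw [mul_pow, pow_right_comm, pow_right_comm w⁻¹, inv_pow, hp.pow_eq_one]
      simp
    rw [geom_sum_eq hne, h1]
    simp

theorem mubDiag5_pow (j : ℕ) :
    mubDiag5 ^ j = Matrix.diagonal fun k : Fin 5 => zeta30 ^ (6 * (j * k.val ^ 2)) := by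
  rw [mubDiag5, Matrix.diagonal_pow]
  congr 1
  funext k
  have h : (![1, zeta30 ^ 6, (zeta30 ^ 6) ^ 4, (zeta30 ^ 6) ^ 4, zeta30 ^ 6] : Fin 5 → ℂ) k =
      zeta30 ^ (6 * k.val ^ 2) := by
    fin_cases k
    · simp
    · simp
    · simp [← pow_mul]
    · simp only [← pow_mul]
      exact zeta30_pow_eq_of_mod (by norm_num)
    · exact zeta30_pow_eq_of_mod (by norm_num)
  rw [Pi.pow_apply, exp_div_five_eq, h, ← pow_mul]
  congr 1
  ring

theorem fourierMatrix_five_apply (k a : Fin 5) :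
    fourierMatrix 5 k a = zeta30 ^ (6 * (k.val * a.val)) / (Real.sqrt 5 : ℂ) := by
  simp only [fourierMatrix, Matrix.of_apply]
  rw [pow_mul _ 6, ← exp_div_five_eq]
  norm_num

theorem fourierMatrix_three_apply (k a : Fin 3) :
    fourierMatrix 3 k a = zeta30 ^ (10 * (k.val * a.val)) / (Real.sqrt 3 : ℂ) := by
  simp only [fourierMatrix, Matrix.of_apply]
  rw [pow_mul _ 10, ← exp_div_three_eq]
  norm_num

theorem mubH5_apply (j : ℕ) (k a : Fin 5) :
    mubH5 j k a = zeta30 ^ (6 * (j * k.val ^ 2 + k.val * a.val)) / (Real.sqrt 5 : ℂ) := by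
  rw [mubH5, mubDiag5_pow, Matrix.diagonal_mul, fourierMatrix_five_apply, mul_div_assoc',
    ← pow_add, mul_add]

theorem mubH5_zero : mubH5 0 = fourierMatrix 5 := by
  rw [mubH5, pow_zero, one_mul]

theorem sqrt_five_mul_self : (Real.sqrt 5 : ℂ) * (Real.sqrt 5 : ℂ) = 5 := by
  rw [← Complex.ofReal_mul, Real.mul_self_sqrt (by norm_num)]
  norm_num

theorem sqrt_five_ne_zero : (Real.sqrt 5 : ℂ) ≠ 0 := by
  intro h
  simpa [h] using sqrt_five_mul_self

/-- The inner product is a Gauss sum with quadratic coefficient n - m and linear coefficient b - a;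
the factor 4 stands for -1 modulo 5. -/
theorem mubH5_conjTranspose_mul_apply {m n : ℕ} (h : (n + 4 * m) % 5 ≠ 0) (a b : Fin 5) :
    ((mubH5 m)ᴴ * mubH5 n) a b =
      zeta30 ^ gaussExp (n + 4 * m) (b.val + 4 * a.val) / (Real.sqrt 5 : ℂ) := by
  have hterm : ∀ k : Fin 5, (mubH5 m)ᴴ a k * mubH5 n k b =
      zeta30 ^ (6 * ((n + 4 * m) * k.val ^ 2 + (b.val + 4 * a.val) * k.val)) / 5 := fun k => by
    rw [Matrix.conjTranspose_apply, mubH5_apply, mubH5_apply, star_div₀, star_zeta30_pow,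
      Complex.star_def, Complex.conj_ofReal, div_mul_div_comm, sqrt_five_mul_self, ← pow_add]
    congr 1
    apply zeta30_pow_eq_of_mod
    ring_nf
    omega
  rw [Matrix.mul_apply, Finset.sum_congr rfl fun k _ => hterm k, ← Finset.sum_div,
    sum_zeta30_pow_quadratic _ h, ← sqrt_five_mul_self, mul_comm, mul_div_mul_right _ _ sqrt_five_ne_zero]

theorem mubH5_mem_unitaryGroup (j : ℕ) : mubH5 j ∈ Matrix.unitaryGroup (Fin 5) ℂ := by
  refine Submonoid.mul_mem _ ?_ (fourierMatrix_mem_unitaryGroup 5)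
  rw [mubDiag5_pow, Matrix.mem_unitaryGroup_iff, Matrix.star_eq_conjTranspose,
    Matrix.diagonal_conjTranspose, Matrix.diagonal_mul_diagonal, ← Matrix.diagonal_one]
  congr 1
  funext k
  rw [Pi.star_apply, star_zeta30_pow, ← pow_add]
  rw [show ∀ n, n + 29 * n = 30 * n by intro n; ring, pow_mul, zeta30_isPrimitiveRoot.pow_eq_one,
    one_pow]

/-- F₅ counts as H₀, so all bases other than the standard one are treated uniformly. -/
theorem mubSet5_eq (l : Fin 6) : mubSet5 l = if l = 0 then 1 else mubH5 (l.val - 1) := by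
  fin_cases l <;> simp [mubSet5, mubH5_zero]

theorem norm_zeta30_pow_div_sqrt_five_sq (n : ℕ) :
    ‖zeta30 ^ n / (Real.sqrt 5 : ℂ)‖ ^ 2 = 1 / 5 := by
  rw [norm_div, norm_zeta30_pow, Complex.norm_real, div_pow, Real.norm_eq_abs, sq_abs,
    Real.sq_sqrt (by norm_num)]
  norm_num

theorem isCompleteMUBSet_mubSet5 : IsCompleteMUBSet 5 mubSet5 := by
  refine ⟨fun k => ?_, ?_⟩
  · rw [mubSet5_eq]
    split_ifs
    · exact Submonoid.one_mem _
    · exact mubH5_mem_unitaryGroup _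
  · intro k l hkl i j
    have hone : ∀ (m : ℕ) (i j : Fin 5), ‖mubH5 m i j‖ ^ 2 = 1 / 5 := fun m i j => by
      rw [mubH5_apply, norm_zeta30_pow_div_sqrt_five_sq]
    rw [mubSet5_eq, mubSet5_eq]
    push_cast
    split_ifs with hk hl hl
    · exact absurd (hk.trans hl.symm) hkl
    · rw [Matrix.conjTranspose_one, one_mul, hone]
    · rw [mul_one, Matrix.conjTranspose_apply, norm_star, hone]
    · rw [mubH5_conjTranspose_mul_apply _ i j, norm_zeta30_pow_div_sqrt_five_sq]
      revert k l
      decide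

/-! ### The entries of `S15` -/

/-- The blocks of five consecutive rows or columns. -/
def blk (i : Fin 15) : Fin 3 := Fin.ofNat 3 (i.val / 5)

/-- The exponents of the entries `ζ₃₀ ^ phaseExp i k / √15` of `S15`. -/
def phaseExp (i k : Fin 15) : ℕ :=
  let n := (![0, 3, 4] : Fin 3 → ℕ) (blk k)
  let m := i.val / 5
  let a := i.val % 5
  let b := k.val % 5
  if m = 0 then 6 * (n * a ^ 2 + a * b)
  else 10 * (m * (k.val / 5)) + gaussExp (n + 4 * m) (b + 4 * a)

theorem S15_apply (i k : Fin 15) :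
    S15 i k = zeta30 ^ phaseExp i k / (Real.sqrt 15 : ℂ) := by
  have h15 : (Real.sqrt 15 : ℂ) = Real.sqrt 3 * Real.sqrt 5 := by
    rw [← Complex.ofReal_mul, ← Real.sqrt_mul (by norm_num)]
    norm_num
  obtain ⟨⟨m, a⟩, rfl⟩ := (finProdFinEquiv : Fin 3 × Fin 5 ≃ Fin (3 * 5)).surjective i
  obtain ⟨⟨n, b⟩, rfl⟩ := (finProdFinEquiv : Fin 3 × Fin 5 ≃ Fin (3 * 5)).surjective k
  have hS : S15 (finProdFinEquiv (m, a)) (finProdFinEquiv (n, b)) =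
      fourierMatrix 3 m n * (((![1, mubH5 1, mubH5 2] : Fin 3 → Matrix (Fin 5) (Fin 5) ℂ) m)ᴴ *
        (![mubH5 0, mubH5 3, mubH5 4] : Fin 3 → Matrix (Fin 5) (Fin 5) ℂ) n) a b := by
    simp only [S15, blockHadamard, Matrix.reindex_apply, Matrix.submatrix_apply,
      Equiv.symm_apply_apply, Matrix.of_apply, mubSet5, mubH5_zero]
    rfl
  rw [hS, fourierMatrix_three_apply, h15]
  have hL : (![mubH5 0, mubH5 3, mubH5 4] : Fin 3 → Matrix (Fin 5) (Fin 5) ℂ) n =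
      mubH5 ((![0, 3, 4] : Fin 3 → ℕ) n) := by
    fin_cases n <;> rfl
  have hE : ((![1, mubH5 1, mubH5 2] : Fin 3 → Matrix (Fin 5) (Fin 5) ℂ) m)ᴴ *
        (![mubH5 0, mubH5 3, mubH5 4] : Fin 3 → Matrix (Fin 5) (Fin 5) ℂ) n =
      Matrix.of fun a b : Fin 5 => zeta30 ^ (if m = 0 then
        6 * ((![0, 3, 4] : Fin 3 → ℕ) n * a.val ^ 2 + a.val * b.val) else
        gaussExp ((![0, 3, 4] : Fin 3 → ℕ) n + 4 * m.val) (b.val + 4 * a.val)) /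
          (Real.sqrt 5 : ℂ) := by
    ext a b
    rw [hL, Matrix.of_apply]
    have hmod : ∀ m n : Fin 3, m ≠ 0 → ((![0, 3, 4] : Fin 3 → ℕ) n + 4 * m.val) % 5 ≠ 0 := by decide
    split_ifs with hm
    · subst hm
      simp [mubH5_apply]
    · rw [← mubH5_conjTranspose_mul_apply (hmod m n hm)]
      fin_cases m
      · exact absurd rfl hm
      · rfl
      · rfl
  rw [hE, Matrix.of_apply, div_mul_div_comm, ← pow_add]
  congr 1
  apply zeta30_pow_eq_of_mod
  clear hS hL hE
  revert m n a b
  decide +kernel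

theorem sqrt_fifteen_mul_self : (Real.sqrt 15 : ℂ) * (Real.sqrt 15 : ℂ) = 15 := by
  rw [← Complex.ofReal_mul, Real.mul_self_sqrt (by norm_num)]
  norm_num

/-- In the product of two block rows the factor L_n L_n† cancels, so what remains of the K's does
not depend on n, and the sum over n is an entry of M M†. -/
theorem blockHadamard_mem_unitaryGroup {p q : ℕ} {K L : Fin p → Matrix (Fin q) (Fin q) ℂ}
    {M : Matrix (Fin p) (Fin p) ℂ} (hK : ∀ m, K m ∈ Matrix.unitaryGroup (Fin q) ℂ)
    (hL : ∀ m, L m ∈ Matrix.unitaryGroup (Fin q) ℂ) (hM : M ∈ Matrix.unitaryGroup (Fin p) ℂ) :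
    blockHadamard p q K L M ∈ Matrix.unitaryGroup (Fin (p * q)) ℂ := by
  rw [Matrix.mem_unitaryGroup_iff]
  ext i j
  obtain ⟨⟨m, a⟩, rfl⟩ := finProdFinEquiv.surjective i
  obtain ⟨⟨m', a'⟩, rfl⟩ := finProdFinEquiv.surjective j
  have hKL : ∀ n, ((K m)ᴴ * L n) * ((K m')ᴴ * L n)ᴴ = (K m)ᴴ * K m' := fun n => by
    have h := Matrix.mem_unitaryGroup_iff.1 (hL n)
    rw [Matrix.star_eq_conjTranspose] at h
    rw [Matrix.conjTranspose_mul, Matrix.conjTranspose_conjTranspose, Matrix.mul_assoc,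
      ← Matrix.mul_assoc (L n), h, Matrix.one_mul]
  have hterm : ∀ n, ∑ b, (M m n * ((K m)ᴴ * L n) a b) * star (M m' n * ((K m')ᴴ * L n) a' b) =
      M m n * star (M m' n) * ((K m)ᴴ * K m') a a' := fun n => by
    rw [← hKL n, Matrix.mul_apply, Finset.mul_sum]
    refine Finset.sum_congr rfl fun b _ => ?_
    rw [Matrix.conjTranspose_apply, star_mul']
    ring
  have hM1 : ∑ n, M m n * star (M m' n) = (1 : Matrix (Fin p) (Fin p) ℂ) m m' := by
    rw [← Matrix.mem_unitaryGroup_iff.1 hM, Matrix.mul_apply]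
    rfl
  rw [Matrix.mul_apply, ← finProdFinEquiv.sum_comp, Fintype.sum_prod_type]
  simp only [blockHadamard, Matrix.reindex_apply, Matrix.submatrix_apply, Matrix.star_apply,
    Equiv.symm_apply_apply, Matrix.of_apply]
  rw [Finset.sum_congr rfl fun n _ => hterm n, ← Finset.sum_mul, hM1, Matrix.one_apply,
    Matrix.one_apply]
  by_cases hm : m = m'
  · subst hm
    have h := Matrix.mem_unitaryGroup_iff'.1 (hK m)
    rw [Matrix.star_eq_conjTranspose] at h
    rw [if_pos rfl, one_mul, h, Matrix.one_apply]
    simp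
  · rw [if_neg hm, zero_mul, if_neg]
    intro h
    exact hm (congrArg Prod.fst (finProdFinEquiv.injective h))

theorem S15_mem_unitaryGroup : S15 ∈ Matrix.unitaryGroup (Fin 15) ℂ := by
  have h := isCompleteMUBSet_mubSet5.1
  exact blockHadamard_mem_unitaryGroup (p := 3) (q := 5)
    (Fin.forall_fin_succ.2 ⟨h 0, Fin.forall_fin_two.2 ⟨h 2, h 3⟩⟩)
    (Fin.forall_fin_succ.2 ⟨h 1, Fin.forall_fin_two.2 ⟨h 4, h 5⟩⟩)
    (fourierMatrix_mem_unitaryGroup 3)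

theorem norm_S15_apply (i k : Fin 15) : ‖S15 i k‖ = 1 / Real.sqrt 15 := by
  rw [S15_apply, norm_div, norm_zeta30_pow, Complex.norm_real, Real.norm_eq_abs,
    abs_of_nonneg (Real.sqrt_nonneg _)]

theorem isComplexHadamard_S15 : IsComplexHadamard S15 :=
  ⟨S15_mem_unitaryGroup, fun i j k l => by rw [norm_S15_apply, norm_S15_apply]⟩

theorem isButsonHadamard_S15 : IsButsonHadamard 15 30 S15 := by
  refine ⟨isComplexHadamard_S15, fun i j => ?_⟩
  have h := S15_apply i j
  generalize phaseExp i j = e at h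
  refine ⟨zeta30 ^ e, ?_, ?_⟩
  · rw [pow_right_comm, zeta30_isPrimitiveRoot.pow_eq_one, one_pow]
  · rw [h]
    norm_num

/-! ### Kernels of matrices over a cyclotomic ring, by reduction modulo 31 -/

section Reduction

open Polynomial

theorem isPrimitiveRoot_three_zmod : IsPrimitiveRoot (3 : ZMod 31) 30 := by
  rw [IsPrimitiveRoot.iff (by norm_num)]
  refine ⟨by decide, fun l h0 h1 => ?_⟩
  interval_cases l <;> decide

/-- The minimal polynomial Φ₃₀ of ζ divides P, and 3 is a root of Φ₃₀ modulo 31, being a primitive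
root there. So ζ ↦ 3 is a well-defined reduction ℤ[ζ] → 𝔽₃₁. -/
theorem eval_three_eq_zero_of_aeval_zeta30 {P : ℤ[X]} (h : aeval zeta30 P = 0) :
    ((P.eval 3 : ℤ) : ZMod 31) = 0 := by
  have hne : NeZero ((30 : ℕ) : ZMod 31) := ⟨by decide⟩
  have hp : Fact (Nat.Prime 31) := ⟨by norm_num⟩
  have hdvd : cyclotomic 30 ℤ ∣ P := by
    rw [cyclotomic_eq_minpoly zeta30_isPrimitiveRoot (by norm_num)]
    exact minpoly.isIntegrallyClosed_dvd (zeta30_isPrimitiveRoot.isIntegral (by norm_num)) h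
  obtain ⟨Q, rfl⟩ := hdvd
  have h3 : (cyclotomic 30 (ZMod 31)).eval 3 = 0 :=
    isRoot_cyclotomic_iff.2 isPrimitiveRoot_three_zmod
  have hmap := eval_intCast_map (Int.castRingHom (ZMod 31)) (cyclotomic 30 ℤ) 3
  rw [map_cyclotomic_int, Int.cast_ofNat, Int.cast_ofNat, h3, eq_intCast] at hmap
  rw [eval_mul, Int.cast_mul, ← hmap, zero_mul]

/-- The product N A on the unknowns in Q reduces to the identity, so its determinant reduces to 1
and cannot vanish at ζ. Only a left inverse modulo 31 is needed, not one over the cyclotomic field.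
-/
theorem eq_zero_of_mulVec_eq_zero_of_mod {κ ι : Type*} [Fintype κ] [DecidableEq κ] [Fintype ι]
    (A : Matrix ι κ ℤ[X]) (N : Matrix κ ι ℤ) (Q : κ → Prop) [DecidablePred Q]
    (hN : ∀ p q, Q p → Q q →
      ((∑ r, N p r * (A r q).eval 3 : ℤ) : ZMod 31) = if p = q then 1 else 0)
    (c : κ → ℂ) (hc : ∀ q, ¬ Q q → c q = 0) (h : ∀ r, ∑ q, aeval zeta30 (A r q) * c q = 0) :
    c = 0 := by
  let B : Matrix {p // Q p} {p // Q p} ℤ[X] :=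
    Matrix.of fun p q => ∑ r, C (N p r) * A r q
  have hdet : ((B.det.eval 3 : ℤ) : ZMod 31) = 1 := by
    have h1 : ((B.det.eval 3 : ℤ) : ZMod 31) =
        (((Int.castRingHom (ZMod 31)).comp (evalRingHom 3)).mapMatrix B).det := by
      rw [← RingHom.map_det]
      rfl
    have h2 : ((Int.castRingHom (ZMod 31)).comp (evalRingHom 3)).mapMatrix B = 1 := by
      ext p q
      have := hN p q p.2 q.2
      rw [Matrix.one_apply]
      simp only [Subtype.ext_iff]
      rw [← this]
      simp [B, eval_finsetSum]
    rw [h1, h2, Matrix.det_one]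
  have hne : ((aeval zeta30).toRingHom.mapMatrix B).det ≠ 0 := by
    rw [← RingHom.map_det]
    intro h0
    rw [eval_three_eq_zero_of_aeval_zeta30 h0] at hdet
    exact absurd hdet (by decide)
  have hsum : ∀ f : κ → ℂ, ∑ q, f q * c q = ∑ q : {p // Q p}, f q * c q := fun f => by
    rw [← Fintype.sum_subtype_add_sum_subtype Q]
    rw [add_eq_left]
    exact Finset.sum_eq_zero fun q _ => by rw [hc _ q.2, mul_zero]
  have hker : ((aeval zeta30).toRingHom.mapMatrix B) *ᵥ (fun q => c q) = 0 := by
    ext p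
    have h3 : ∑ r, (N p r : ℂ) * ∑ q, aeval zeta30 (A r q) * c q = 0 := by
      simp [h]
    simp only [hsum, Finset.mul_sum] at h3
    rw [Finset.sum_comm] at h3
    rw [Pi.zero_apply, ← h3]
    simp only [Matrix.mulVec, dotProduct]
    refine Finset.sum_congr rfl fun q _ => ?_
    simp [B, Finset.sum_mul, mul_assoc]
  have hz := Matrix.eq_zero_of_mulVec_eq_zero hne hker
  ext q
  by_cases hq : Q q
  · exact congrFun hz ⟨q, hq⟩
  · exact hc q hq

end Reduction

/-! ### The linear systems for the isotypic components of the first-order equations -/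

/-- The first coordinate of the translation in `(ℤ/5)²` that maps the zeroth positions of the
blocks of `i` and `k` to `i` and `k`. -/
def transX (i k : Fin 15) : ℕ :=
  let n := (![0, 3, 4] : Fin 3 → ℕ) (blk k)
  let m := i.val / 5
  if m = 0 then i.val % 5 else (i.val % 5 + 4 * (k.val % 5)) * 3 * (n + 4 * m) ^ 3 % 5

/-- The second coordinate of the translation in `(ℤ/5)²` that maps the zeroth positions of the
blocks of `i` and `k` to `i` and `k`. -/
def transZ (i k : Fin 15) : ℕ :=
  (k.val % 5 + 2 * (![0, 3, 4] : Fin 3 → ℕ) (blk k) * transX i k) % 5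

/-- The exponent of the character `(x, z) ↦ ω ^ (s x + t z)` at the translation that belongs to
the position `(i, k)`. -/
def charExp (s t : Fin 5) (i k : Fin 15) : ℕ :=
  6 * (s * transX i k + t * transZ i k)

/-- The position number `a` in the block `m`. -/
def pos (m : Fin 3) (a : ℕ) : Fin 15 := Fin.ofNat 15 (5 * m.val + a % 5)

/-- The coefficient of the unknown of block `q` in the first-order equation for the rows `i` and
`j`, for phases that transform by the character `(s, t)`. -/
def blockCoeff {S : Type*} [CommRing S] (g : S) (s t : Fin 5) (i j : Fin 15) (q : Fin 3 × Fin 3) :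
    S :=
  ∑ b : Fin 5,
    -- Reducing exponents modulo 30 changes nothing at ζ and bounds the integers that arise at 3.
    ((if blk i = q.1 then g ^ ((phaseExp i (pos q.2 b) + 29 * phaseExp j (pos q.2 b) +
        charExp s t i (pos q.2 b)) % 30) else 0) -
      (if blk j = q.1 then g ^ ((phaseExp i (pos q.2 b) + 29 * phaseExp j (pos q.2 b) +
        charExp s t j (pos q.2 b)) % 30) else 0))

/-- The second row of the equation number `r` in the system for the character `(s, t)`. -/
def secondRow (s t : Fin 5) (r : Fin 3 × Fin 3) : Fin 15 :=
  -- For two rows of the same block, the first at position zero, the sum over each column block is a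
  -- sum of a character of ℤ/5. This offset is the only one at which that character is trivial; all
  -- others give the equation 0 = 0. The offset is 0, and the equation void, exactly when (s, t) is
  -- constant along the rows of the block.
  pos r.2 (if r.1 = r.2 then
    (![0, 4, 4] : Fin 3 → ℕ) r.1 * s + (![1, 3, 1] : Fin 3 → ℕ) r.1 * t else 0)

/-- The unknowns that remain when the trivial solutions are subtracted. -/
def isReducedUnknown (s t : Fin 5) (q : Fin 3 × Fin 3) : Bool :=
  if s = 0 ∧ t = 0 then q.1 ≠ 0 ∧ q.2 ≠ 0
  else ¬ (q = (0, 0) ∧ t = 0 ∨ q = (1, 0) ∧ s = 3 * t ∨ q = (2, 0) ∧ s = t ∨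
    q = (0, 0) ∧ s = 0 ∨ q = (0, 1) ∧ s = 4 * t ∨ q = (0, 2) ∧ s = 2 * t)

/-- The left inverses modulo 31 of the systems at `3`, a primitive thirtieth root of unity.  The
rows are coded as numbers in base 31. -/
def leftInverse (s t : Fin 5) (p r : Fin 3 × Fin 3) : ℤ :=
  (![
    ![![0, 0, 0, 0, 417353, 655929, 0, 257678975, 486704743],
      ![0, 652750165543, 556725795720, 652754782516, 324595985177, 228547068207, 419120765418,
        125626238657, 213662161448],
      ![0, 255297535563, 670409952930, 255309064164, 210890021557, 626005835478, 461318632406,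
        639211805280, 471380745843],
      ![0, 255297535563, 670409952930, 255309064164, 210890021557, 626005835478, 461318632406,
        639211805280, 471380745843],
      ![0, 652750165543, 556725795720, 652754782516, 324595985177, 228547068207, 419120765418,
        125626238657, 213662161448]],
    ![![0, 1672564885473, 25020778882981, 12869962732371, 8096761867297, 13399160242856,
        19446744113502, 13722826463958, 25601490435611],
      ![791425498606, 327375693165, 143072564176, 23821777884, 223782641724, 324653898055, 0,
        285470942938, 195848105343],
      ![1164290659666, 1460459535952, 11928079006136, 0, 18591370080246, 13653872627036,
        15911567400237, 1895708063495, 26342770566321],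
      ![255309719802, 255309719800, 0, 20615522, 21420408, 648667271224, 344997991758,
        456743143459, 471391678776],
      ![6524856, 0, 27557060, 626017691703, 50183106882, 626032468039, 505719890513, 661862427648,
        682261977971]],
    ![![0, 7043801009059, 22802371879634, 13904192227396, 19258277643824, 13720835168108,
        7968990181989, 13203063396381, 1629241578109],
      ![652756064028, 652756064036, 0, 13525195, 24369874, 192049751636, 319487884389,
        682363920470, 213685428720],
      ![715349739802, 670401762050, 117398381241, 658455719079, 169667318419, 752925754610, 0,
        89209735483, 312302558221],
      ![12125260, 0, 13555106, 228560623311, 393098058148, 228559699790, 451111251634,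
        517840129540, 509828356482],
      ![20278887251827, 19636877834899, 17318947505369, 0, 25953786282053, 14332698215812,
        10091661977630, 13234054578408, 7485893868602]],
    ![![0, 7043801009059, 22802371879634, 13904192227396, 19258277643824, 13720835168108,
        7968990181989, 13203063396381, 1629241578109],
      ![20278887251827, 19636877834899, 17318947505369, 0, 25953786282053, 14332698215812,
        10091661977630, 13234054578408, 7485893868602],
      ![12125260, 0, 13555106, 228560623311, 393098058148, 228559699790, 451111251634,
        517840129540, 509828356482],
      ![715349739802, 670401762050, 117398381241, 658455719079, 169667318419, 752925754610, 0,
        89209735483, 312302558221],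
      ![652756064028, 652756064036, 0, 13525195, 24369874, 192049751636, 319487884389,
        682363920470, 213685428720]],
    ![![0, 1672564885473, 25020778882981, 12869962732371, 8096761867297, 13399160242856,
        19446744113502, 13722826463958, 25601490435611],
      ![6524856, 0, 27557060, 626017691703, 50183106882, 626032468039, 505719890513, 661862427648,
        682261977971],
      ![255309719802, 255309719800, 0, 20615522, 21420408, 648667271224, 344997991758,
        456743143459, 471391678776],
      ![1164290659666, 1460459535952, 11928079006136, 0, 18591370080246, 13653872627036,
        15911567400237, 1895708063495, 26342770566321],
      ![791425498606, 327375693165, 143072564176, 23821777884, 223782641724, 324653898055, 0,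
        285470942938, 195848105343]]] : Fin 5 → Fin 5 → Fin 9 → ℕ) s t (finProdFinEquiv p) / 31 ^ (3 * r.1.val + r.2.val) % 31

theorem leftInverse_mul_blockCoeff : ∀ (s t : Fin 5) (p q : Fin 3 × Fin 3),
    isReducedUnknown s t p → isReducedUnknown s t q →
      (∑ r, leftInverse s t p r * blockCoeff (3 : ℤ) s t (pos r.1 0) (secondRow s t r) q) % 31 =
        if p = q then 1 else 0 := by
  decide +kernel

/-- One formula thus serves over ℤ[X], at 3 and at ζ. -/
theorem map_blockCoeff {S S' : Type*} [CommRing S] [CommRing S'] (f : S →+* S') (g : S)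
    (s t : Fin 5) (i j : Fin 15) (q : Fin 3 × Fin 3) :
    f (blockCoeff g s t i j q) = blockCoeff (f g) s t i j q := by
  simp only [blockCoeff, map_sum, map_sub, apply_ite f, map_pow, map_zero]

/-- The system for the character `(s, t)` has no nonzero solution in the reduced unknowns. -/
theorem eq_zero_of_blockCoeff_system (s t : Fin 5) (c : Fin 3 × Fin 3 → ℂ)
    (hc : ∀ q, ¬ isReducedUnknown s t q → c q = 0)
    (h : ∀ i j, ∑ q, blockCoeff zeta30 s t i j q * c q = 0) : c = 0 := by
  refine eq_zero_of_mulVec_eq_zero_of_mod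
    (fun r q => blockCoeff (Polynomial.X : Polynomial ℤ) s t (pos r.1 0) (secondRow s t r) q)
    (leftInverse s t) (fun q => isReducedUnknown s t q) (fun p q hp hq => ?_) c hc (fun r => ?_)
  · have h1 := leftInverse_mul_blockCoeff s t p q hp hq
    have h2 : ∀ r, (blockCoeff (Polynomial.X : Polynomial ℤ) s t (pos r.1 0) (secondRow s t r)
        q).eval 3 = blockCoeff (3 : ℤ) s t (pos r.1 0) (secondRow s t r) q := fun r => by
      rw [← Polynomial.coe_evalRingHom, map_blockCoeff, Polynomial.coe_evalRingHom,
        Polynomial.eval_X]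
    simp only [h2]
    rw [← ZMod.intCast_mod, Nat.cast_ofNat, h1]
    split_ifs <;> simp
  · have h2 : ∀ q, Polynomial.aeval zeta30 (blockCoeff (Polynomial.X : Polynomial ℤ) s t
        (pos r.1 0) (secondRow s t r) q) =
          blockCoeff zeta30 s t (pos r.1 0) (secondRow s t r) q := fun q => by
      rw [← AlgHom.coe_toRingHom, map_blockCoeff, AlgHom.coe_toRingHom, Polynomial.aeval_X]
    simp only [h2]
    exact h _ _

/-! ### Decomposition of an invariant subspace under an operator of finite order -/

/-- Discrete Fourier inversion: n x is the sum of the projections y_s of x to the eigenspaces of T,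
and each y_s stays in W. -/
theorem submodule_le_of_eigenvectors {M : Type*} [AddCommGroup M] [Module ℂ M] (T : M →ₗ[ℂ] M)
    {n : ℕ} (hn : n ≠ 0) {w : ℂ} (hw : IsPrimitiveRoot w n) (hT : T ^ n = 1) {W U : Submodule ℂ M}
    (hW : ∀ x ∈ W, T x ∈ W) (hU : ∀ s < n, ∀ x ∈ W, T x = w ^ s • x → x ∈ U) : W ≤ U := by
  intro x hx
  have hw0 : w ≠ 0 := hw.ne_zero hn
  let y : ℕ → M := fun s => ∑ r ∈ Finset.range n, (w⁻¹) ^ (s * r) • (T ^ r) x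
  have hpow : ∀ r, (T ^ r) x ∈ W := fun r => by
    induction r with
    | zero => simpa using hx
    | succ r ih =>
      rw [pow_succ', Module.End.mul_apply]
      exact hW _ ih
  have hyW : ∀ s, y s ∈ W := fun s => W.sum_mem fun r _ => W.smul_mem _ (hpow r)
  have hyT : ∀ s, T (y s) = w ^ s • y s := fun s => by
    -- Cyclic shift of the summation index: the terms for r = 0 and r = n agree.
    have h1 : y s = ∑ r ∈ Finset.range n, (w⁻¹) ^ (s * (r + 1)) • (T ^ (r + 1)) x := by
      have h2 := Finset.sum_range_succ (fun r => (w⁻¹) ^ (s * r) • (T ^ r) x) n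
      rw [Finset.sum_range_succ', hT, mul_comm s n, pow_mul _ n, hw.inv.pow_eq_one] at h2
      simp only [one_pow, mul_zero, pow_zero] at h2
      exact (add_right_cancel h2).symm
    conv_rhs => rw [h1, Finset.smul_sum]
    simp only [y, map_sum, map_smul]
    refine Finset.sum_congr rfl fun r _ => ?_
    rw [smul_smul, pow_succ' T, Module.End.mul_apply]
    congr 1
    rw [mul_add, mul_one, pow_add, mul_left_comm, ← mul_pow, mul_inv_cancel₀ hw0, one_pow, mul_one]
  have hsum : ∑ s ∈ Finset.range n, y s = (n : ℂ) • x := by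
    simp only [y]
    rw [Finset.sum_comm, Finset.sum_eq_single 0]
    · simp [Nat.cast_smul_eq_nsmul]
    · intro r hr hr0
      rw [← Finset.sum_smul]
      have hne : (w⁻¹) ^ r ≠ 1 :=
        hw.inv.pow_ne_one_of_pos_of_lt hr0 (Finset.mem_range.1 hr)
      have h1 : ((w⁻¹) ^ r) ^ n = 1 := by
        rw [pow_right_comm, hw.inv.pow_eq_one, one_pow]
      have h2 : ∑ s ∈ Finset.range n, (w⁻¹) ^ (s * r) = 0 := by
        simp only [mul_comm _ r, pow_mul]
        rw [geom_sum_eq hne, h1, sub_self, zero_div]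
      rw [h2, zero_smul]
    · intro h
      simp at h
      omega
  have hmem : (n : ℂ) • x ∈ U := by
    rw [← hsum]
    exact U.sum_mem fun s hs => hU s (Finset.mem_range.1 hs) _ (hyW s) (hyT s)
  have hn0 : (n : ℂ) ≠ 0 := by exact_mod_cast hn
  simpa [smul_smul, hn0] using U.smul_mem (n : ℂ)⁻¹ hmem

/-! ### The complexified first-order equations for `S15` -/

/-- The derivative of the unitarity equation for the rows `i` and `j` of `S15`, up to a factor. -/
noncomputable def unitarityDeriv (R : Fin 15 → Fin 15 → ℂ) (i j : Fin 15) : ℂ :=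
  ∑ k, zeta30 ^ (phaseExp i k + 29 * phaseExp j k) * (R i k - R j k)

/-- The complex solutions of the first-order equations for `S15`. -/
noncomputable def complexFirstOrderSpace : Submodule ℂ (Fin 15 → Fin 15 → ℂ) where
  carrier := {R | ∀ i j, unitarityDeriv R i j = 0}
  zero_mem' := by simp [unitarityDeriv]
  add_mem' := by
    intro R T hR hT i j
    have h := congrArg₂ (· + ·) (hR i j) (hT i j)
    simp only [unitarityDeriv, add_zero, ← Finset.sum_add_distrib] at h
    rw [← h]
    refine Finset.sum_congr rfl fun k _ => ?_
    simp only [Pi.add_apply]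
    ring
  smul_mem' := by
    intro c R hR i j
    have h := congrArg (c * ·) (hR i j)
    simp only [unitarityDeriv, mul_zero, Finset.mul_sum] at h
    rw [← h]
    refine Finset.sum_congr rfl fun k _ => ?_
    simp only [Pi.smul_apply, smul_eq_mul]
    ring

/-- The matrices `a i + b k`, the phases that come from multiplying rows and columns. -/
def additiveMatrices : Submodule ℂ (Fin 15 → Fin 15 → ℂ) where
  carrier := {R | ∃ a b : Fin 15 → ℂ, ∀ i k, R i k = a i + b k}
  zero_mem' := ⟨0, 0, by simp⟩
  add_mem' := by
    rintro R T ⟨a, b, h⟩ ⟨a', b', h'⟩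
    refine ⟨a + a', b + b', fun i k => ?_⟩
    simp only [Pi.add_apply, h, h']
    ring
  smul_mem' := by
    rintro c R ⟨a, b, h⟩
    refine ⟨c • a, c • b, fun i k => ?_⟩
    simp only [Pi.smul_apply, smul_eq_mul, h]
    ring

theorem S15_mul_star_S15 (i j k : Fin 15) :
    S15 i k * star (S15 j k) = zeta30 ^ (phaseExp i k + 29 * phaseExp j k) / 15 := by
  rw [S15_apply, S15_apply, star_div₀, star_zeta30_pow, Complex.star_def, Complex.conj_ofReal,
    div_mul_div_comm, sqrt_fifteen_mul_self, ← pow_add]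

theorem sum_zeta30_pow_phaseExp {i j : Fin 15} (hij : i ≠ j) :
    ∑ k, zeta30 ^ (phaseExp i k + 29 * phaseExp j k) = 0 := by
  have h := congrFun (congrFun (Matrix.mem_unitaryGroup_iff.1 S15_mem_unitaryGroup) i) j
  rw [Matrix.mul_apply, Matrix.one_apply_ne hij] at h
  simp only [Matrix.star_apply, S15_mul_star_S15] at h
  rw [← Finset.sum_div, div_eq_zero_iff] at h
  exact h.resolve_right (by norm_num)

/-- The b_k cancel in the difference, and a_i - a_j multiplies the inner product of two orthogonal
rows. -/
theorem additiveMatrices_le : additiveMatrices ≤ complexFirstOrderSpace := by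
  rintro R ⟨a, b, h⟩ i j
  rcases eq_or_ne i j with rfl | hij
  · simp [unitarityDeriv]
  · simp only [unitarityDeriv, h, add_sub_add_right_eq_sub]
    rw [← Finset.sum_mul, sum_zeta30_pow_phaseExp hij, zero_mul]

/-! ### The translation symmetry -/

/-- The action of the first generator of `(ℤ/5)²` on the rows. -/
def rowX (i : Fin 15) : Fin 15 := pos (blk i) (i.val % 5 + (![1, 3, 6] : Fin 3 → ℕ) (blk i))

/-- The action of the second generator of `(ℤ/5)²` on the rows. -/
def rowZ (i : Fin 15) : Fin 15 := pos (blk i) (i.val % 5 + (![0, 1, 1] : Fin 3 → ℕ) (blk i))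

/-- The action of the first generator of `(ℤ/5)²` on the columns. -/
def colX (k : Fin 15) : Fin 15 := pos (blk k) (k.val % 5 + (![0, 9, 12] : Fin 3 → ℕ) (blk k))

/-- The action of the second generator of `(ℤ/5)²` on the columns. -/
def colZ (k : Fin 15) : Fin 15 := pos (blk k) (k.val % 5 + 1)

/-- The pull-back of matrices along maps of the rows and columns. -/
def pullback (ρ κ : Fin 15 → Fin 15) : (Fin 15 → Fin 15 → ℂ) →ₗ[ℂ] (Fin 15 → Fin 15 → ℂ) where
  toFun R i k := R (ρ i) (κ k)
  map_add' _ _ := rfl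
  map_smul' _ _ := rfl

theorem pullback_pow_apply (ρ κ : Fin 15 → Fin 15) (n : ℕ) (R : Fin 15 → Fin 15 → ℂ)
    (i k : Fin 15) : (pullback ρ κ ^ n) R i k = R (ρ^[n] i) (κ^[n] k) := by
  induction n generalizing i k with
  | zero => rfl
  | succ n ih =>
    rw [pow_succ', Module.End.mul_apply, Function.iterate_succ_apply, Function.iterate_succ_apply,
      ← ih]
    rfl

/-- A permutation of rows and columns that fixes `S15` up to row phases u and column phases v
permutes the equations: v cancels within a pair of rows, and u comes out of the sum. -/
theorem pullback_mem {ρ κ : Fin 15 → Fin 15} (hκ : Function.Bijective κ) (u v : Fin 15 → ℕ)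
    (h : ∀ i k, phaseExp (ρ i) (κ k) % 30 = (phaseExp i k + u i + v k) % 30)
    {R : Fin 15 → Fin 15 → ℂ} (hR : R ∈ complexFirstOrderSpace) :
    pullback ρ κ R ∈ complexFirstOrderSpace := by
  intro i j
  have hterm : ∀ k, zeta30 ^ (phaseExp i k + 29 * phaseExp j k) *
      (pullback ρ κ R i k - pullback ρ κ R j k) = zeta30 ^ (29 * u i + u j) *
        (zeta30 ^ (phaseExp (ρ i) (κ k) + 29 * phaseExp (ρ j) (κ k)) *
          (R (ρ i) (κ k) - R (ρ j) (κ k))) := fun k => by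
    rw [← mul_assoc, ← pow_add]
    congr 1
    apply zeta30_pow_eq_of_mod
    have h1 := h i k
    have h2 := h j k
    omega
  rw [unitarityDeriv, Finset.sum_congr rfl fun k _ => hterm k, ← Finset.mul_sum,
    hκ.sum_comp fun k => zeta30 ^ (phaseExp (ρ i) k + 29 * phaseExp (ρ j) k) *
      (R (ρ i) k - R (ρ j) k)]
  exact mul_eq_zero_of_right _ (hR _ _)

theorem pullback_X_mem {R : Fin 15 → Fin 15 → ℂ} (hR : R ∈ complexFirstOrderSpace) :
    pullback rowX colX R ∈ complexFirstOrderSpace :=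
  -- The phases are read off from column 0 and row 0; the last summand of the column phase removes
  -- the corner, which is counted twice.
  pullback_mem (by decide) (fun i => phaseExp (rowX i) (colX 0) + 29 * phaseExp i 0)
    (fun k => phaseExp (rowX 0) (colX k) + 29 * phaseExp 0 k +
      29 * (phaseExp (rowX 0) (colX 0) + 29 * phaseExp 0 0)) (by decide +kernel) hR

theorem pullback_Z_mem {R : Fin 15 → Fin 15 → ℂ} (hR : R ∈ complexFirstOrderSpace) :
    pullback rowZ colZ R ∈ complexFirstOrderSpace :=
  pullback_mem (by decide) (fun i => phaseExp (rowZ i) (colZ 0) + 29 * phaseExp i 0)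
    (fun k => phaseExp (rowZ 0) (colZ k) + 29 * phaseExp 0 k +
      29 * (phaseExp (rowZ 0) (colZ 0) + 29 * phaseExp 0 0)) (by decide +kernel) hR

theorem pullback_pow_five {ρ κ : Fin 15 → Fin 15} (hρ : ∀ i, ρ^[5] i = i) (hκ : ∀ k, κ^[5] k = k) :
    pullback ρ κ ^ 5 = 1 := by
  refine LinearMap.ext fun R => ?_
  funext i k
  rw [pullback_pow_apply, hρ, hκ]
  rfl

/-! ### Solutions that transform by a character -/

/-- The matrix that transforms by the character `(s, t)` and has the entries `c` at the zeroth
positions of the blocks. -/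
noncomputable def characterMatrix (s t : Fin 5) (c : Fin 3 × Fin 3 → ℂ) (i k : Fin 15) : ℂ :=
  zeta30 ^ charExp s t i k * c (blk i, blk k)

theorem sum_eq_sum_pos (f : Fin 15 → ℂ) : ∑ k, f k = ∑ n : Fin 3, ∑ b : Fin 5, f (pos n b) := by
  rw [← (finProdFinEquiv : Fin 3 × Fin 5 ≃ Fin 15).sum_comp, Fintype.sum_prod_type]
  refine Finset.sum_congr rfl fun n _ => Finset.sum_congr rfl fun b _ => ?_
  congr 1
  revert n b
  decide

theorem unitarityDeriv_characterMatrix (s t : Fin 5) (c : Fin 3 × Fin 3 → ℂ) (i j : Fin 15) :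
    unitarityDeriv (characterMatrix s t c) i j = ∑ q, blockCoeff zeta30 s t i j q * c q := by
  have hblk : ∀ (n : Fin 3) (b : Fin 5), blk (pos n b) = n := by decide
  have hred : ∀ n, zeta30 ^ (n % 30) = zeta30 ^ n := fun n => zeta30_pow_eq_of_mod (Nat.mod_mod _ _)
  rw [unitarityDeriv, sum_eq_sum_pos, Fintype.sum_prod_type_right]
  refine Finset.sum_congr rfl fun n _ => ?_
  simp only [blockCoeff, Finset.sum_mul, hred]
  rw [Finset.sum_comm]
  refine Finset.sum_congr rfl fun b _ => ?_
  simp only [sub_mul, ite_mul, zero_mul, Finset.sum_sub_distrib, Finset.sum_ite_eq,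
    Finset.mem_univ, if_true, characterMatrix, hblk]
  rw [pow_add _ _ (charExp s t i _), pow_add _ _ (charExp s t j _)]
  ring

theorem iterate_apply_of_eigen {ρ κ : Fin 15 → Fin 15} {R : Fin 15 → Fin 15 → ℂ} {e : ℕ}
    (h : ∀ i k, R (ρ i) (κ k) = zeta30 ^ e * R i k) (n : ℕ) (i k : Fin 15) :
    R (ρ^[n] i) (κ^[n] k) = zeta30 ^ (e * n) * R i k := by
  induction n with
  | zero => simp
  | succ n ih =>
    rw [Function.iterate_succ_apply', Function.iterate_succ_apply', h, ih]
    ring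

/-- Every position is a translate of the zeroth position of its block, by the amounts `transX` and
`transZ`. -/
theorem eq_characterMatrix {s t : Fin 5} {R : Fin 15 → Fin 15 → ℂ}
    (hX : ∀ i k, R (rowX i) (colX k) = zeta30 ^ (6 * s.val) * R i k)
    (hZ : ∀ i k, R (rowZ i) (colZ k) = zeta30 ^ (6 * t.val) * R i k) :
    R = characterMatrix s t fun q => R (pos q.1 0) (pos q.2 0) := by
  have key : ∀ i k, rowX^[transX i k] (rowZ^[transZ i k] (pos (blk i) 0)) = i ∧
      colX^[transX i k] (colZ^[transZ i k] (pos (blk k) 0)) = k := by decide +kernel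
  funext i k
  have h := iterate_apply_of_eigen hX (transX i k) (rowZ^[transZ i k] (pos (blk i) 0))
    (colZ^[transZ i k] (pos (blk k) 0))
  rw [iterate_apply_of_eigen hZ, (key i k).1, (key i k).2] at h
  rw [h, characterMatrix, charExp]
  ring

/-- Each character is trivial, or it is constant along the rows of one block of rows, or along the
columns of one block of columns; the normalized unknowns are chosen accordingly. -/
theorem character_cases : ∀ s t : Fin 5, s = 0 ∧ t = 0 ∨
    (∃ m, (∀ i k, blk i = m → charExp s t i k % 30 = charExp s t i 0 % 30) ∧
      ∀ q, ¬ isReducedUnknown s t q → q = (m, 0)) ∨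
    (∃ n, (∀ i k, blk k = n → charExp s t i k % 30 = charExp s t 0 k % 30) ∧
      ∀ q, ¬ isReducedUnknown s t q → q = (0, n)) := by
  decide +kernel

/-- For the trivial character, the first row and column of the 3 × 3 matrix c are matched by an
additive one. Otherwise the character, cut off to the row or column block on which it is constant in
the other index, depends on one index only and is additive. -/
theorem exists_additive_normalization (s t : Fin 5) (c : Fin 3 × Fin 3 → ℂ) :
    ∃ c₀, characterMatrix s t c₀ ∈ additiveMatrices ∧
      ∀ q, ¬ isReducedUnknown s t q → c q = c₀ q := by
  rcases character_cases s t with ⟨rfl, rfl⟩ | ⟨m, h1, h2⟩ | ⟨n, h1, h2⟩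
  · refine ⟨fun q => c (q.1, 0) + (c (0, q.2) - c (0, 0)),
      ⟨fun i => c (blk i, 0), fun k => c (0, blk k) - c (0, 0), fun i k => ?_⟩, ?_⟩
    · simp [characterMatrix, charExp]
    · rintro ⟨m, n⟩ hq
      have : m = 0 ∨ n = 0 := by
        revert m n
        decide
      rcases this with rfl | rfl <;> simp
  · refine ⟨fun q => if q.1 = m then c (m, 0) else 0,
      ⟨fun i => if blk i = m then zeta30 ^ charExp s t i 0 * c (m, 0) else 0, 0, fun i k => ?_⟩, ?_⟩
    · simp only [characterMatrix, Pi.zero_apply, add_zero]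
      split_ifs with h
      · rw [zeta30_pow_eq_of_mod (h1 i k h)]
      · rw [mul_zero]
    · intro q hq
      rw [h2 q hq]
      simp
  · refine ⟨fun q => if q.2 = n then c (0, n) else 0,
      ⟨0, fun k => if blk k = n then zeta30 ^ charExp s t 0 k * c (0, n) else 0, fun i k => ?_⟩, ?_⟩
    · simp only [characterMatrix, Pi.zero_apply, zero_add]
      split_ifs with h
      · rw [zeta30_pow_eq_of_mod (h1 i k h)]
      · rw [mul_zero]
    · intro q hq
      rw [h2 q hq]
      simp

theorem mem_additiveMatrices_of_eigen {s t : Fin 5} {R : Fin 15 → Fin 15 → ℂ}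
    (hR : R ∈ complexFirstOrderSpace)
    (hX : ∀ i k, R (rowX i) (colX k) = zeta30 ^ (6 * s.val) * R i k)
    (hZ : ∀ i k, R (rowZ i) (colZ k) = zeta30 ^ (6 * t.val) * R i k) :
    R ∈ additiveMatrices := by
  obtain ⟨c, rfl⟩ : ∃ c, R = characterMatrix s t c := ⟨_, eq_characterMatrix hX hZ⟩
  obtain ⟨c₀, hc₀, hnorm⟩ := exists_additive_normalization s t c
  have hc : c - c₀ = 0 := by
    refine eq_zero_of_blockCoeff_system s t _ (fun q hq => ?_) fun i j => ?_
    · rw [Pi.sub_apply, hnorm q hq, sub_self]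
    · simp only [Pi.sub_apply, mul_sub, Finset.sum_sub_distrib]
      rw [← unitarityDeriv_characterMatrix, ← unitarityDeriv_characterMatrix, hR i j,
        additiveMatrices_le hc₀ i j, sub_self]
  rw [sub_eq_zero.1 hc]
  exact hc₀

theorem complexFirstOrderSpace_le : complexFirstOrderSpace ≤ additiveMatrices := by
  have hw : IsPrimitiveRoot (zeta30 ^ 6) 5 :=
    zeta30_isPrimitiveRoot.pow (by norm_num) (by norm_num)
  refine submodule_le_of_eigenvectors (pullback rowX colX) (by norm_num) hw
    (pullback_pow_five (by decide +kernel) (by decide +kernel)) (fun R => pullback_X_mem) ?_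
  intro s hs R₁ hR₁ hX₁
  -- The second generator commutes with the first, so it preserves the eigenspaces of the first and
  -- can be diagonalized within each.
  refine submodule_le_of_eigenvectors
    (W := complexFirstOrderSpace ⊓ LinearMap.ker (pullback rowX colX - (zeta30 ^ 6) ^ s • 1))
    (pullback rowZ colZ) (by norm_num) hw
    (pullback_pow_five (by decide +kernel) (by decide +kernel)) ?_ ?_ ⟨hR₁, ?_⟩
  · rintro R ⟨hR, hX⟩
    refine ⟨pullback_Z_mem hR, ?_⟩
    have hrow : ∀ i, rowZ (rowX i) = rowX (rowZ i) := by decide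
    have hcol : ∀ k, colZ (colX k) = colX (colZ k) := by decide
    funext i k
    have h := congrFun (congrFun hX (rowZ i)) (colZ k)
    change R (rowZ (rowX i)) (colZ (colX k)) - (zeta30 ^ 6) ^ s * R (rowZ i) (colZ k) = 0
    rw [hrow, hcol]
    exact h
  · rintro t ht R ⟨hR, hX⟩ hZ
    refine mem_additiveMatrices_of_eigen (s := ⟨s, hs⟩) (t := ⟨t, ht⟩) hR (fun i k => ?_)
      fun i k => ?_
    · rw [pow_mul]
      exact sub_eq_zero.1 (congrFun (congrFun hX i) k)
    · rw [pow_mul]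
      exact congrFun (congrFun hZ i) k
  · exact LinearMap.mem_ker.2 (sub_eq_zero.2 hX₁)

theorem firstOrderSpace_S15 : firstOrderSpace S15 = ⊥ := by
  rw [eq_bot_iff]
  rintro R ⟨h0, h1, h2⟩
  have hmem : (fun i k => (R i k : ℂ)) ∈ additiveMatrices := by
    refine complexFirstOrderSpace_le fun i j => ?_
    have h := h2 i j
    simp only [S15_mul_star_S15, div_mul_eq_mul_div] at h
    rw [← Finset.sum_div, div_eq_zero_iff] at h
    exact h.resolve_right (by norm_num)
  obtain ⟨a, b, hab⟩ := hmem
  rw [Submodule.mem_bot]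
  ext i k
  have e1 := hab i k
  have e2 := hab 0 k
  have e3 := hab i 0
  have e4 := hab 0 0
  simp only [h0, h1, Complex.ofReal_zero] at e1 e2 e3 e4
  have : (R i k : ℂ) = 0 := by linear_combination e1 - e2 - e3 + e4
  exact_mod_cast this

theorem defect_S15 : defect S15 = 0 := by
  rw [defect, firstOrderSpace_S15, finrank_bot]

/-! ### Vanishing defect implies isolation -/

theorem IsComplexHadamard.norm_apply {d : ℕ} {H : Matrix (Fin d) (Fin d) ℂ}
    (hH : IsComplexHadamard H) (i j : Fin d) : ‖H i j‖ = (Real.sqrt d)⁻¹ := by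
  have h1 : ∑ k, H i k * star (H i k) = 1 := by
    have h := congrFun (congrFun (Matrix.mem_unitaryGroup_iff.1 hH.1) i) i
    rwa [Matrix.mul_apply, Matrix.one_apply_eq] at h
  have h2 : ∀ k, H i k * star (H i k) = ((‖H i j‖ ^ 2 : ℝ) : ℂ) := fun k => by
    rw [hH.2 i j i k, Complex.star_def, Complex.mul_conj, Complex.normSq_eq_norm_sq]
  simp only [h2, Finset.sum_const, Finset.card_univ, Fintype.card_fin, nsmul_eq_mul] at h1
  have h3 : (d : ℝ) * ‖H i j‖ ^ 2 = 1 := by exact_mod_cast h1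
  rw [← Real.sqrt_inv, eq_comm, Real.sqrt_eq_iff_eq_sq (by positivity) (norm_nonneg _)]
  exact inv_eq_of_mul_eq_one_right h3

/-- Both H and its twist satisfy the exact unitarity equations, so the linear term equals minus the
remainder of the exponential, which is quadratic in the phases. -/
theorem norm_sum_mul_le_of_phaseTwist_mem {d : ℕ} {H : Matrix (Fin d) (Fin d) ℂ}
    (hH : H ∈ Matrix.unitaryGroup (Fin d) ℂ) {R : Matrix (Fin d) (Fin d) ℝ} {ε : ℝ}
    (hε : ε ≤ 1 / 2) (hR : ∀ i j, |R i j| ≤ ε)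
    (hU : phaseTwist H R ∈ Matrix.unitaryGroup (Fin d) ℂ) (i j : Fin d) :
    ‖∑ k, H i k * star (H j k) * ((R i k : ℂ) - (R j k : ℂ))‖ ≤ d * (4 * ε ^ 2) := by
  have h1 : ∑ k, H i k * star (H j k) = (1 : Matrix (Fin d) (Fin d) ℂ) i j := by
    rw [← Matrix.mem_unitaryGroup_iff.1 hH, Matrix.mul_apply]
    rfl
  have h2 : ∑ k, H i k * star (H j k) * Complex.exp (Complex.I * ((R i k : ℂ) - (R j k : ℂ))) =
      (1 : Matrix (Fin d) (Fin d) ℂ) i j := by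
    rw [← Matrix.mem_unitaryGroup_iff.1 hU, Matrix.mul_apply]
    refine Finset.sum_congr rfl fun k _ => ?_
    have hs : star (Complex.exp (Complex.I * (R j k : ℂ))) =
        Complex.exp (-(Complex.I * (R j k : ℂ))) := by
      rw [Complex.star_def, ← Complex.exp_conj]
      simp
    rw [Matrix.star_apply, phaseTwist, Matrix.of_apply, Matrix.of_apply, star_mul', hs, mul_sub,
      sub_eq_add_neg, Complex.exp_add]
    ring
  have h3 : Complex.I * ∑ k, H i k * star (H j k) * ((R i k : ℂ) - (R j k : ℂ)) =
      -∑ k, H i k * star (H j k) * (Complex.exp (Complex.I * ((R i k : ℂ) - (R j k : ℂ))) - 1 -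
        Complex.I * ((R i k : ℂ) - (R j k : ℂ))) := by
    simp only [mul_sub _ _ (Complex.I * _), mul_sub _ _ (1 : ℂ), mul_one, Finset.sum_sub_distrib,
      h1, h2, sub_self, zero_sub, neg_neg, Finset.mul_sum]
    refine Finset.sum_congr rfl fun k _ => ?_
    ring
  have h4 := congrArg norm h3
  rw [norm_mul, Complex.norm_I, one_mul, norm_neg] at h4
  rw [h4]
  refine (norm_sum_le_of_le (f := fun k => H i k * star (H j k) *
    (Complex.exp (Complex.I * ((R i k : ℂ) - (R j k : ℂ))) - 1 -
      Complex.I * ((R i k : ℂ) - (R j k : ℂ)))) (n := fun _ => 4 * ε ^ 2) Finset.univ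
        fun k _ => ?_).trans ?_
  · have hθ : ‖Complex.I * ((R i k : ℂ) - (R j k : ℂ))‖ ≤ 2 * ε := by
      rw [norm_mul, Complex.norm_I, one_mul, ← Complex.ofReal_sub, Complex.norm_real,
        Real.norm_eq_abs]
      have := abs_sub (R i k) (R j k)
      linarith [hR i k, hR j k]
    have hle := Complex.norm_exp_sub_one_sub_id_le (hθ.trans (by linarith))
    have hHk : ‖H i k * star (H j k)‖ ≤ 1 := by
      rw [norm_mul, norm_star]
      exact mul_le_one₀ (entry_norm_bound_of_unitary hH i k) (norm_nonneg _)
        (entry_norm_bound_of_unitary hH j k)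
    rw [norm_mul]
    calc _ ≤ 1 * ‖Complex.I * ((R i k : ℂ) - (R j k : ℂ))‖ ^ 2 :=
          mul_le_mul hHk hle (norm_nonneg _) zero_le_one
      _ ≤ 1 * (2 * ε) ^ 2 := by gcongr
      _ = 4 * ε ^ 2 := by ring
  · simp

/-- The first-order equations together with the normalization of the first row and column. -/
noncomputable def firstOrderMap {d : ℕ} [NeZero d] (H : Matrix (Fin d) (Fin d) ℂ) :
    (Fin d → Fin d → ℝ) →ₗ[ℝ] (Fin d → Fin d → ℂ) × (Fin d → ℝ) × (Fin d → ℝ) where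
  toFun R := (fun i j => ∑ k, H i k * star (H j k) * ((R i k : ℂ) - (R j k : ℂ)),
    fun j => R 0 j, fun i => R i 0)
  map_add' R T := by
    refine Prod.ext ?_ rfl
    funext i j
    simp only [Prod.fst_add, Pi.add_apply, ← Finset.sum_add_distrib]
    refine Finset.sum_congr rfl fun k _ => ?_
    push_cast
    ring
  map_smul' c R := by
    refine Prod.ext ?_ rfl
    funext i j
    simp only [Prod.smul_fst, Pi.smul_apply, Finset.smul_sum, RingHom.id_apply, smul_eq_mul,
      Complex.real_smul]
    refine Finset.sum_congr rfl fun k _ => ?_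
    push_cast
    ring

theorem exists_pos_of_firstOrderSpace_eq_bot {d : ℕ} [NeZero d] {H : Matrix (Fin d) (Fin d) ℂ}
    (hH : H ∈ Matrix.unitaryGroup (Fin d) ℂ) (h : firstOrderSpace H = ⊥) :
    ∃ ε > 0, ∀ R : Matrix (Fin d) (Fin d) ℝ, (∀ i j, |R i j| ≤ ε) → (∀ j, R 0 j = 0) →
      (∀ i, R i 0 = 0) → phaseTwist H R ∈ Matrix.unitaryGroup (Fin d) ℂ → R = 0 := by
  have hker : LinearMap.ker (firstOrderMap H) = ⊥ := by
    rw [eq_bot_iff]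
    intro R hR
    have hR' : firstOrderMap H R = 0 := hR
    have hmem : (Matrix.of R) ∈ firstOrderSpace H :=
      ⟨fun j => congrFun (congrArg (fun x => x.2.1) hR') j,
        fun i => congrFun (congrArg (fun x => x.2.2) hR') i,
        fun i j => congrFun (congrFun (congrArg (fun x => x.1) hR') i) j⟩
    rw [h, Submodule.mem_bot] at hmem
    exact hmem
  -- An injective linear map on a finite-dimensional space is bounded below.
  obtain ⟨C, hC, hanti⟩ := LinearMap.exists_antilipschitzWith _ hker
  have hd : (0 : ℝ) < d := by exact_mod_cast Nat.pos_of_ne_zero (NeZero.ne d)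
  have hC' : (0 : ℝ) < C := hC
  -- The bound 1/2 keeps phase differences at most 1, as the exponential estimate requires; the
  -- other bound turns ‖R‖ ≤ 4Cd‖R‖² into ‖R‖ ≤ ‖R‖/2.
  refine ⟨min (1 / 2) (1 / (C * (d * 8))), by positivity, fun R hR h0 h1 hU => ?_⟩
  let f : Fin d → Fin d → ℝ := R
  have hf : ‖f‖ ≤ min (1 / 2) (1 / (C * (d * 8))) :=
    (pi_norm_le_iff_of_nonneg (by positivity)).2 fun i =>
      (pi_norm_le_iff_of_nonneg (by positivity)).2 fun j => hR i j
  have hfR : ∀ i j, |R i j| ≤ ‖f‖ := fun i j => (norm_le_pi_norm (f i) j).trans (norm_le_pi_norm f i)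
  have hE : ‖firstOrderMap H f‖ ≤ d * (4 * ‖f‖ ^ 2) := by
    have hnn : 0 ≤ d * (4 * ‖f‖ ^ 2) := by positivity
    refine norm_prod_le_iff.2 ⟨?_, norm_prod_le_iff.2 ⟨?_, ?_⟩⟩
    · refine (pi_norm_le_iff_of_nonneg hnn).2 fun i => (pi_norm_le_iff_of_nonneg hnn).2 fun j => ?_
      exact norm_sum_mul_le_of_phaseTwist_mem hH (hf.trans (min_le_left _ _)) hfR hU i j
    · refine (pi_norm_le_iff_of_nonneg hnn).2 fun j => ?_
      change ‖R 0 j‖ ≤ _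
      rw [h0, norm_zero]
      exact hnn
    · refine (pi_norm_le_iff_of_nonneg hnn).2 fun i => ?_
      change ‖R i 0‖ ≤ _
      rw [h1, norm_zero]
      exact hnn
  have hle : ‖f‖ ≤ C * ‖firstOrderMap H f‖ := by
    have := hanti.le_mul_dist f 0
    rwa [map_zero, dist_zero_right, dist_zero_right] at this
  have hf2 : ‖f‖ * (C * (d * 8)) ≤ 1 := by
    rw [← le_div_iff₀ (by positivity)]
    exact hf.trans (min_le_right _ _)
  have hf0 : ‖f‖ = 0 := by
    have h2 : ‖f‖ ≤ C * (d * (4 * ‖f‖ ^ 2)) := hle.trans (by gcongr)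
    have h3 : C * (d * (4 * ‖f‖ ^ 2)) ≤ ‖f‖ / 2 := by
      have := mul_le_mul_of_nonneg_left hf2 (norm_nonneg f)
      linarith
    linarith [norm_nonneg f]
  exact norm_eq_zero.1 hf0

theorem isIsolatedHadamard_of_firstOrderSpace_eq_bot {d : ℕ} [NeZero d]
    {H : Matrix (Fin d) (Fin d) ℂ} (hH : IsComplexHadamard H) (h : firstOrderSpace H = ⊥) :
    IsIsolatedHadamard H := by
  refine ⟨hH, ?_⟩
  obtain ⟨ε, hε, hR⟩ := exists_pos_of_firstOrderSpace_eq_bot hH.1 h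
  have hr : (Real.sqrt d)⁻¹ ≠ 0 :=
    inv_ne_zero (Real.sqrt_ne_zero'.2 (by exact_mod_cast Nat.pos_of_ne_zero (NeZero.ne d)))
  have hH0 : ∀ i j, H i j ≠ 0 := fun i j h0 => hr (by rw [← hH.norm_apply i j, h0, norm_zero])
  -- The entrywise quotient of K by H, dephased to equal 1 in the first row and column. It is
  -- continuous at H with value 1, so its arguments are small phases near H.
  let z : Matrix (Fin d) (Fin d) ℂ → Fin d → Fin d → ℂ := fun K i j =>
    (K 0 0 * H i 0 / (H 0 0 * K i 0)) * (K i j / H i j) * (H 0 j / K 0 j)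
  have hzH : ∀ i j, z H i j = 1 := fun i j => by
    have h1 := hH0 0 0
    have h2 := hH0 i 0
    have h3 := hH0 0 j
    have h4 := hH0 i j
    simp only [z]
    field_simp
  have hent : ∀ i j, ContinuousAt (fun K : Matrix (Fin d) (Fin d) ℂ => K i j) H := fun i j =>
    (continuous_id.matrix_elem i j).continuousAt
  have hz : ∀ i j, ContinuousAt (fun K => z K i j) H := fun i j =>
    ((((hent 0 0).mul continuousAt_const).div (continuousAt_const.mul (hent i 0))
      (mul_ne_zero (hH0 _ _) (hH0 _ _))).mul ((hent i j).div continuousAt_const (hH0 _ _))).mul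
        (continuousAt_const.div (hent 0 j) (hH0 _ _))
  have hev : ∀ᶠ K in 𝓝 H, ∀ i j, |(z K i j).arg| ≤ ε := by
    refine Filter.eventually_all.2 fun i => Filter.eventually_all.2 fun j => ?_
    have harg : ContinuousAt (fun K => |(z K i j).arg|) H := by
      refine ContinuousAt.abs (ContinuousAt.comp (g := Complex.arg) ?_ (hz i j))
      rw [hzH]
      exact Complex.continuousAt_arg Complex.one_mem_slitPlane
    refine (harg.tendsto.eventually_lt_const (u := ε) ?_).mono fun K hK => hK.le
    rw [hzH, Complex.arg_one, abs_zero]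
    exact hε
  filter_upwards [hev] with K hK hKH
  have hK0 : ∀ i j, K i j ≠ 0 := fun i j h0 => hr (by rw [← hKH.norm_apply i j, h0, norm_zero])
  have hnorm : ∀ i j k l, ‖K i j‖ = ‖H k l‖ := fun i j k l => by
    rw [hKH.norm_apply, hH.norm_apply]
  have hH0' : ∀ i j, ‖H i j‖ ≠ 0 := fun i j => norm_ne_zero_iff.2 (hH0 i j)
  let u : Fin d → ℂ := fun i => K 0 0 * H i 0 / (H 0 0 * K i 0)
  let v : Fin d → ℂ := fun j => H 0 j / K 0 j
  have hu : ∀ i, ‖u i‖ = 1 := fun i => by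
    simp only [u, norm_div, norm_mul]
    rw [hnorm 0 0 0 0, hnorm i 0 i 0]
    exact div_self (mul_ne_zero (hH0' _ _) (hH0' _ _))
  have hv : ∀ j, ‖v j‖ = 1 := fun j => by
    simp only [v, norm_div]
    rw [hnorm 0 j 0 j]
    exact div_self (hH0' _ _)
  have hz1 : ∀ i j, ‖z K i j‖ = 1 := fun i j => by
    change ‖u i * (K i j / H i j) * v j‖ = 1
    rw [norm_mul, norm_mul, hu, hv, norm_div, hnorm i j i j, div_self (hH0' _ _), one_mul, one_mul]
  have htwist : phaseTwist H (Matrix.of fun i j => (z K i j).arg) =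
      Matrix.diagonal u * K * Matrix.diagonal v := by
    ext i j
    have hexp : Complex.exp (Complex.I * ((z K i j).arg : ℂ)) = z K i j := by
      have := Complex.norm_mul_exp_arg_mul_I (z K i j)
      rwa [hz1, Complex.ofReal_one, one_mul, mul_comm] at this
    rw [phaseTwist, Matrix.of_apply, Matrix.of_apply, hexp, Matrix.mul_diagonal,
      Matrix.diagonal_mul]
    change H i j * (u i * (K i j / H i j) * v j) = _
    have := hH0 i j
    field_simp
  have hdiag : ∀ w : Fin d → ℂ, (∀ i, ‖w i‖ = 1) →
      Matrix.diagonal w ∈ Matrix.unitaryGroup (Fin d) ℂ := fun w hw => by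
    rw [Matrix.mem_unitaryGroup_iff, Matrix.star_eq_conjTranspose, Matrix.diagonal_conjTranspose,
      Matrix.diagonal_mul_diagonal, ← Matrix.diagonal_one]
    congr 1
    funext i
    rw [Pi.star_apply, Complex.star_def, Complex.mul_conj, Complex.normSq_eq_norm_sq, hw]
    simp
  have hzero := hR (Matrix.of fun i j => (z K i j).arg) hK
    (fun j => by
      have h1 := hH0 0 0
      have h2 := hH0 0 j
      have h3 := hK0 0 0
      have h4 := hK0 0 j
      have : z K 0 j = 1 := by simp only [z]; field_simp
      rw [Matrix.of_apply, this, Complex.arg_one])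
    (fun i => by
      have h1 := hH0 0 0
      have h2 := hH0 i 0
      have h3 := hK0 0 0
      have h4 := hK0 i 0
      have : z K i 0 = 1 := by simp only [z]; field_simp
      rw [Matrix.of_apply, this, Complex.arg_one])
    (by
      rw [htwist]
      exact Submonoid.mul_mem _ (Submonoid.mul_mem _ (hdiag u hu) hKH.1) (hdiag v hv))
  refine ⟨u, v, 1, 1, hu, hv, ?_⟩
  rw [Matrix.permMatrix_one, mul_one, mul_one, ← htwist, hzero]
  ext i j
  simp [phaseTwist]

/-! ### First-order solutions and equivalence -/

/-- A first-order solution at K, permuted, is one at H. Subtracting an additive matrix, which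
orthogonality of the rows permits, normalizes it into the zero space. Cross differences are what
this subtraction leaves unchanged. -/
theorem crossDifference_eq_zero_of_hadamardEquiv {d : ℕ} [NeZero d]
    {H K : Matrix (Fin d) (Fin d) ℂ} (hH : H ∈ Matrix.unitaryGroup (Fin d) ℂ)
    (h : firstOrderSpace H = ⊥) (hHK : HadamardEquiv H K) {R : Fin d → Fin d → ℝ}
    (hR : ∀ i j, ∑ k, K i k * star (K j k) * ((R i k : ℂ) - (R j k : ℂ)) = 0) (i j k l : Fin d) :
    R i k - R i l - R j k + R j l = 0 := by
  obtain ⟨u, v, σ, τ, hu, hv, hE⟩ := hHK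
  have hent : ∀ i k, H i k = u i * K (σ i) (τ.symm k) * v k := fun i k => by
    rw [hE, Matrix.mul_diagonal, Matrix.mul_assoc, Matrix.mul_assoc, Matrix.diagonal_mul,
      Equiv.Perm.permMatrix, Equiv.Perm.permMatrix, PEquiv.toMatrix_toPEquiv_mul,
      PEquiv.mul_toMatrix_toPEquiv]
    rfl
  have horth : ∀ i j, i ≠ j → ∑ k, H i k * star (H j k) = 0 := fun i j hij => by
    have h := congrFun (congrFun (Matrix.mem_unitaryGroup_iff.1 hH) i) j
    rwa [Matrix.mul_apply, Matrix.one_apply_ne hij] at h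
  have hperm : ∀ i j, ∑ k, H i k * star (H j k) *
      ((R (σ i) (τ.symm k) : ℂ) - (R (σ j) (τ.symm k) : ℂ)) = 0 := fun i j => by
    have hterm : ∀ k, H i k * star (H j k) *
        ((R (σ i) (τ.symm k) : ℂ) - (R (σ j) (τ.symm k) : ℂ)) = u i * star (u j) *
          (K (σ i) (τ.symm k) * star (K (σ j) (τ.symm k)) *
            ((R (σ i) (τ.symm k) : ℂ) - (R (σ j) (τ.symm k) : ℂ))) := fun k => by
      have hvv : v k * star (v k) = 1 := by
        rw [Complex.star_def, Complex.mul_conj, Complex.normSq_eq_norm_sq, hv]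
        simp
      rw [hent, hent, star_mul', star_mul']
      linear_combination (u i * star (u j) * (K (σ i) (τ.symm k) * star (K (σ j) (τ.symm k)) *
            ((R (σ i) (τ.symm k) : ℂ) - (R (σ j) (τ.symm k) : ℂ)))) * hvv
    rw [Finset.sum_congr rfl fun k _ => hterm k, ← Finset.mul_sum,
      Equiv.sum_comp τ.symm fun k => K (σ i) k * star (K (σ j) k) *
        ((R (σ i) k : ℂ) - (R (σ j) k : ℂ)), hR, mul_zero]
  have hmem : (Matrix.of fun i k => R (σ i) (τ.symm k) - R (σ i) (τ.symm 0) -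
      R (σ 0) (τ.symm k) + R (σ 0) (τ.symm 0)) ∈ firstOrderSpace H := by
    refine ⟨fun k => ?_, fun i => ?_, fun i j => ?_⟩
    · rw [Matrix.of_apply]
      ring
    · rw [Matrix.of_apply]
      ring
    · rcases eq_or_ne i j with rfl | hij
      · simp
      have h1 := hperm i j
      have h2 := horth i j hij
      calc _ = ∑ k, (H i k * star (H j k) *
            ((R (σ i) (τ.symm k) : ℂ) - (R (σ j) (τ.symm k) : ℂ)) -
            H i k * star (H j k) * ((R (σ i) (τ.symm 0) : ℂ) - (R (σ j) (τ.symm 0) : ℂ))) :=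
          Finset.sum_congr rfl fun k _ => by
            simp only [Matrix.of_apply]
            push_cast
            ring
        _ = 0 := by
          rw [Finset.sum_sub_distrib, h1, ← Finset.sum_mul, h2, zero_mul, sub_zero]
  rw [h, Submodule.mem_bot] at hmem
  have hz : ∀ i k, R i k - R i (τ.symm 0) - R (σ 0) k + R (σ 0) (τ.symm 0) = 0 := fun i k => by
    have := congrFun (congrFun hmem (σ.symm i)) (τ k)
    simpa using this
  linarith [hz i k, hz i l, hz j k, hz j l]

/-! ### The Fourier family -/

/-- A solution of the first-order equations for a matrix with entries `ζ₃₀ ^ (2 i k) / √15` times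
phases: it is invariant under a shift of the columns and vanishes for those pairs of rows for which
the shift gives no phase factor. -/
theorem sum_twisted_fourier_eq_zero (p : Fin 15) (G : Fin 15 → Fin 15 → ℂ)
    (A R : Fin 15 → Fin 15 → ℝ)
    (hG : ∀ i k, G i k = zeta30 ^ (2 * (i.val * k.val)) / (Real.sqrt 15 : ℂ) *
      Complex.exp (Complex.I * (A i k : ℂ)))
    (hA : ∀ i k, A i (k + p) = A i k) (hRp : ∀ i k, R i (k + p) = R i k)
    (hR : ∀ i j : Fin 15, 30 ∣ 2 * p.val * (i.val + 29 * j.val) → ∀ k, R i k = R j k)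
    (i j : Fin 15) : ∑ k, G i k * star (G j k) * ((R i k : ℂ) - (R j k : ℂ)) = 0 := by
  by_cases hij : 30 ∣ 2 * p.val * (i.val + 29 * j.val)
  · refine Finset.sum_eq_zero fun k _ => ?_
    rw [hR i j hij k, sub_self, mul_zero]
  have hshift : ∀ i k, G i (k + p) = zeta30 ^ (2 * (i.val * p.val)) * G i k := fun i k => by
    have hpow : zeta30 ^ (2 * (i.val * (k + p).val)) =
        zeta30 ^ (2 * (i.val * p.val)) * zeta30 ^ (2 * (i.val * k.val)) := by
      rw [← pow_add]
      apply zeta30_pow_eq_of_mod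
      rw [Fin.val_add, ← mul_add, ← mul_add, show 30 = 2 * 15 by norm_num, Nat.mul_mod_mul_left,
        Nat.mul_mod_mul_left, add_comm p.val]
      simp [Nat.mul_mod]
    rw [hG, hG, hA, hpow]
    ring
  have h1 : ∑ k, G i k * star (G j k) * ((R i k : ℂ) - (R j k : ℂ)) =
      zeta30 ^ (2 * p.val * (i.val + 29 * j.val)) *
        ∑ k, G i k * star (G j k) * ((R i k : ℂ) - (R j k : ℂ)) := by
    conv_lhs => rw [← Equiv.sum_comp (Equiv.addRight p)]
    rw [Finset.mul_sum]
    refine Finset.sum_congr rfl fun k _ => ?_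
    rw [Equiv.coe_addRight, hshift, hshift, hRp, hRp, star_mul', star_zeta30_pow]
    ring
  have hne : zeta30 ^ (2 * p.val * (i.val + 29 * j.val)) ≠ 1 := fun h =>
    hij (zeta30_isPrimitiveRoot.dvd_of_pow_eq_one _ h)
  by_contra h0
  exact hne (mul_right_cancel₀ h0 (by rw [one_mul]; exact h1.symm))

theorem exp_div_fifteen_eq : Complex.exp (2 * Real.pi * Complex.I / 15) = zeta30 ^ 2 := by
  rw [zeta30, ← Complex.exp_nat_mul]
  congr 1
  push_cast
  ring

theorem phaseTwist_fourierMatrix_apply (A : Matrix (Fin 15) (Fin 15) ℝ) (i k : Fin 15) :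
    phaseTwist (fourierMatrix 15) A i k = zeta30 ^ (2 * (i.val * k.val)) / (Real.sqrt 15 : ℂ) *
      Complex.exp (Complex.I * (A i k : ℂ)) := by
  simp only [phaseTwist, fourierMatrix, Matrix.of_apply]
  rw [pow_mul _ 2, ← exp_div_fifteen_eq]
  norm_num

/-- A direction in the Fourier family. -/
def fourierDirection (i k : Fin 15) : ℝ := if i.val % 3 = 1 ∧ k.val % 5 = 1 then 1 else 0

/-- The column shift by 5 preserves residues modulo 5, and its phase on a pair of rows is trivial
only if they agree modulo 3, where the direction has equal rows. For the transpose, 3 and 5 exchange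
roles. The direction has cross difference 1 at rows and columns 0, 1. -/
theorem not_hadamardEquiv_S15_of_mem {F : Matrix (Fin 15) (Fin 15) ℂ} (hF : F ∈ fourierFamily15) :
    ¬ HadamardEquiv S15 F := by
  obtain ⟨A, ⟨-, hA⟩, rfl⟩ := hF
  have hk : ∀ k : Fin 15, (k + 5).val % 5 = k.val % 5 := by decide
  intro h
  have := crossDifference_eq_zero_of_hadamardEquiv S15_mem_unitaryGroup firstOrderSpace_S15 h
    (sum_twisted_fourier_eq_zero 5 _ A fourierDirection (phaseTwist_fourierMatrix_apply A)
      (fun i k => hA _ _ _ _ rfl (hk k)) (fun i k => by simp only [fourierDirection, hk])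
      (fun i j hij k => by
        have : i.val % 3 = j.val % 3 := by
          revert i j
          decide
        simp only [fourierDirection, this])) 1 0 1 0
  norm_num [fourierDirection] at this

theorem not_hadamardEquiv_S15_transpose_of_mem {F : Matrix (Fin 15) (Fin 15) ℂ}
    (hF : F ∈ fourierFamily15) : ¬ HadamardEquiv S15 Fᵀ := by
  obtain ⟨A, ⟨-, hA⟩, rfl⟩ := hF
  have hk : ∀ k : Fin 15, (k + 3).val % 3 = k.val % 3 := by decide
  intro h
  have := crossDifference_eq_zero_of_hadamardEquiv S15_mem_unitaryGroup firstOrderSpace_S15 h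
    (sum_twisted_fourier_eq_zero 3 _ (fun i k => A k i) (fun i k => fourierDirection k i)
      (fun i k => by
        rw [Matrix.transpose_apply, phaseTwist_fourierMatrix_apply, mul_comm k.val])
      (fun i k => hA _ _ _ _ (hk k) rfl) (fun i k => by simp only [fourierDirection, hk])
      (fun i j hij k => by
        have : i.val % 5 = j.val % 5 := by
          revert i j
          decide
        simp only [fourierDirection, this])) 1 0 1 0
  norm_num [fourierDirection] at this

theorem mainTheorem5 :
    IsCompleteMUBSet 5 mubSet5 ∧
    IsButsonHadamard 15 30 S15 ∧
    defect S15 = 0 ∧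
    IsIsolatedHadamard S15 ∧
    (∀ F ∈ fourierFamily15, ¬ HadamardEquiv S15 F) ∧
    (∀ F ∈ fourierFamily15, ¬ HadamardEquiv S15 Fᵀ) :=
  ⟨isCompleteMUBSet_mubSet5, isButsonHadamard_S15, defect_S15,
    isIsolatedHadamard_of_firstOrderSpace_eq_bot isComplexHadamard_S15 firstOrderSpace_S15,
    fun _ hF => not_hadamardEquiv_S15_of_mem hF,
    fun _ hF => not_hadamardEquiv_S15_transpose_of_mem hF⟩
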